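/- Let $A$ be a separable C$^*$-algebra with a densely defined, faithful, semifinite, lower semicontinuous, positive trace $\tau$. Let $L^2(A,\tau)$ be its GNS Hilbert space (inner products are linear in the second variable), with modular conjugation $J$ extending $a\mapsto a^*$ and standard cone $L^2_+(A,\tau)$, the closure of the positive square integrable elements of $A$. For $\xi=J\xi$ let $\xi\wedge 1$ be the Hilbert projection of $\xi$ onto the $L^2$-closure of $\{a=a^*\in A\cap L^2(A,\tau): a\le 1\}$. Let $(\mathcal E,\mathcal F)$ be a C$^*$-Dirichlet form on $L^2(A,\tau)$: a closed, densely defined, nonnegative quadratic form which is real ($J\xi\in\mathcal F$ and $\mathcal E[J\xi]=\mathcal E[\xi]$ for $\xi\in\mathcal F$) and Markovian ($\xi\wedge 1\in\mathcal F$ and $\mathcal E[\xi\wedge 1]\le\mathcal E[\xi]$ for $\xi=J\xi\in\mathcal F$), whose amplifications $\mathcal E_n[[\xi_{ij}]]=\sum_{i,j}\mathcal E[\xi_{ij}]$ on $\mathbb M_n(\mathcal F)\subseteq L^2(\mathbb M_n(A),\tau\otimes \mathrm{tr}_n)$ are real and Markovian for all $n\ge 1$, and which is regular: $\mathcal B:=A\cap\mathcal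 F$ is norm dense in $A$ and is a form core. Put $\langle\xi,\eta\rangle_{\mathcal F}=\mathcal E(\xi,\eta)+(\xi,\eta)_{L^2(A,\tau)}$, $\|\xi\|_{\mathcal F}=\langle\xi,\xi\rangle_{\mathcal F}^{1/2}$, $\mathcal B_+=\mathcal B\cap L^2_+(A,\tau)$ and $\mathcal F_+=\mathcal F\cap L^2_+(A,\tau)$. A positive functional $\omega\in A^*_+$ has finite energy if there is $c_\omega\ge 0$ with $\omega(b)\le c_\omega\|b\|_{\mathcal F}$ for all $b\in\mathcal B_+$. Its potential is the unique $G(\omega)\in\mathcal F$ with $\omega(b)=\langle G(\omega),b\rangle_{\mathcal F}$ for all $b\in\mathcal B$. With $\omega$ extended to $\mathcal F$ by $\omega(\xi)=\langle G(\omega),\xi\rangle_{\mathcal F}$, its energy content is $\mathcal E[\omega]:=\omega(G(\omega))=\|G(\omega)\|_{\mathcal F}^2$. **Proposition.** Let $\omega,\omega'\in A^*_+$ with $\omega'\le\omega$, and suppose that $\omega$ has finite energy. Then $\omega'$ has finite energy, the (existing and unique) potentials of $\omega$ and $\omega'$ satisfy $G(\omega')\le G(\omega)$, meaning that $G(\omega)-G(\omega')\in\mathcal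 F_+$, and $\mathcal E[\omega']\le\mathcal E[\omega]$. -/

import Mathlib

open scoped ENNReal NNReal ComplexOrder

/-- A densely defined, faithful, semifinite, lower semicontinuous, positive trace
`τ : A₊ → [0, ∞]` on a C⋆-algebra `A`. Only the values of `toFun` on positive elements matter. -/
structure CStarTrace (A : Type*) [NonUnitalCStarAlgebra A] [PartialOrder A] [StarOrderedRing A] where
  toFun : A → ℝ≥0∞
  map_add' : ∀ a b : A, 0 ≤ a → 0 ≤ b → toFun (a + b) = toFun a + toFun b
  map_smul' : ∀ (r : ℝ≥0) (a : A), 0 ≤ a → toFun ((r : ℝ) • a) = r * toFun a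
  tracial' : ∀ a : A, toFun (star a * a) = toFun (a * star a)
  faithful' : ∀ a : A, 0 ≤ a → toFun a = 0 → a = 0
  lowerSemicontinuous' : LowerSemicontinuousOn toFun {a | 0 ≤ a}
  denselyDefined' : ∀ a : A, 0 ≤ a → a ∈ closure {b : A | 0 ≤ b ∧ toFun b < ∞}
  semifinite' : ∀ a : A, 0 ≤ a → IsLUB (toFun '' {b : A | 0 ≤ b ∧ b ≤ a ∧ toFun b < ∞}) (toFun a)

namespace CStarTrace

variable {A : Type*} [NonUnitalCStarAlgebra A] [PartialOrder A] [StarOrderedRing A]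

instance : CoeFun (CStarTrace A) (fun _ => A → ℝ≥0∞) := ⟨CStarTrace.toFun⟩

variable (τ : CStarTrace A)

lemma parallelogram (a b : A) :
    τ (star (a + b) * (a + b)) + τ (star (a - b) * (a - b)) =
      2 * (τ (star a * a) + τ (star b * b)) := by
  have h : star (a + b) * (a + b) + star (a - b) * (a - b) =
      (star a * a + star a * a) + (star b * b + star b * b) := by
    simp only [star_add, star_sub]; noncomm_ring
  have p := fun x : A => star_mul_self_nonneg x
  rw [← τ.map_add' _ _ (p _) (p _), h, τ.map_add' _ _ (add_nonneg (p _) (p _))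
    (add_nonneg (p _) (p _)), τ.map_add' _ _ (p _) (p _), τ.map_add' _ _ (p _) (p _)]
  ring

lemma apply_star_smul (c : ℂ) (a : A) :
    τ (star (c • a) * (c • a)) = (‖c‖₊ ^ 2 : ℝ≥0) * τ (star a * a) := by
  rw [← τ.map_smul' _ _ (star_mul_self_nonneg a)]
  congr 1
  rw [star_smul, smul_mul_smul_comm, RCLike.star_def, ← Complex.normSq_eq_conj_mul_self,
    Complex.normSq_eq_norm_sq, Complex.coe_smul]
  simp

/-- The square integrable elements `A ∩ L²(A, τ) = {a | τ(a⋆a) < ∞}`. -/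
def sqIntegrable : Submodule ℂ A where
  carrier := {a | τ (star a * a) < ∞}
  zero_mem' := by
    have h := τ.map_smul' 0 (0 : A) le_rfl
    simp only [smul_zero, ENNReal.coe_zero, zero_mul] at h
    simp [h]
  add_mem' {a b} ha hb := by
    have h := τ.parallelogram a b
    simp only [Set.mem_ofPred_eq] at *
    refine lt_of_le_of_lt (le_self_add (b := τ (star (a - b) * (a - b)))) ?_
    rw [h]
    exact ENNReal.mul_lt_top (by simp) (ENNReal.add_lt_top.2 ⟨ha, hb⟩)
  smul_mem' c a ha := by
    simp only [Set.mem_ofPred_eq] at *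
    rw [τ.apply_star_smul]
    exact ENNReal.mul_lt_top (by simp) ha

lemma star_mem {a : A} (ha : a ∈ τ.sqIntegrable) : star a ∈ τ.sqIntegrable := by
  change τ (star (star a) * star a) < ∞
  rw [star_star, ← τ.tracial']
  exact ha

/-- The space `A ∩ L²(A, τ)` carrying the `L²`-norm `‖a‖₂ = τ(a⋆a)^{1/2}` instead of the norm
of `A`. -/
def PreL2 : Type _ := τ.sqIntegrable

noncomputable instance : AddCommGroup τ.PreL2 := inferInstanceAs (AddCommGroup τ.sqIntegrable)
noncomputable instance : Module ℂ τ.PreL2 := inferInstanceAs (Module ℂ τ.sqIntegrable)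

/-- The identity map onto the space with the changed norm. -/
noncomputable def toPreL2 : τ.sqIntegrable ≃ₗ[ℂ] τ.PreL2 := LinearEquiv.refl ℂ _

/-- The underlying element of `A`. -/
noncomputable def PreL2.val {τ : CStarTrace A} (x : τ.PreL2) : A := (τ.toPreL2.symm x : A)

noncomputable instance : Norm τ.PreL2 := ⟨fun x => √(τ (star x.val * x.val)).toReal⟩

lemma preL2_norm_sq (x : τ.PreL2) : ‖x‖ ^ 2 = (τ (star x.val * x.val)).toReal :=
  Real.sq_sqrt ENNReal.toReal_nonneg

lemma preL2_norm_nonneg (x : τ.PreL2) : 0 ≤ ‖x‖ := Real.sqrt_nonneg _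

lemma preL2_lt_top (x : τ.PreL2) : τ (star x.val * x.val) < ∞ := (τ.toPreL2.symm x).2

lemma preL2_parallelogram (x y : τ.PreL2) :
    ‖x + y‖ ^ 2 + ‖x - y‖ ^ 2 = 2 * (‖x‖ ^ 2 + ‖y‖ ^ 2) := by
  simp only [preL2_norm_sq]
  rw [← ENNReal.toReal_add (τ.preL2_lt_top _).ne (τ.preL2_lt_top _).ne,
    ← ENNReal.toReal_add (τ.preL2_lt_top _).ne (τ.preL2_lt_top _).ne]
  have h := congrArg ENNReal.toReal (τ.parallelogram x.val y.val)
  rw [ENNReal.toReal_mul] at h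
  exact h

lemma preL2_norm_smul (c : ℂ) (x : τ.PreL2) : ‖c • x‖ = ‖c‖ * ‖x‖ := by
  rw [← sq_eq_sq₀ (τ.preL2_norm_nonneg _) (mul_nonneg (norm_nonneg _) (τ.preL2_norm_nonneg _)),
    mul_pow, preL2_norm_sq, preL2_norm_sq]
  have h := congrArg ENNReal.toReal (τ.apply_star_smul c x.val)
  rw [ENNReal.toReal_mul, ENNReal.coe_toReal, NNReal.coe_pow, coe_nnnorm] at h
  exact h

lemma preL2_norm_add_le (x y : τ.PreL2) : ‖x + y‖ ≤ ‖x‖ + ‖y‖ := by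
  -- rescaling the parallelogram law: `‖x + y‖² ≤ (1 + t) ‖x‖² + (1 + 1/t) ‖y‖²` for `t > 0`
  have key : ∀ t : ℝ, 0 < t → ‖x + y‖ ^ 2 ≤ (1 + t) * ‖x‖ ^ 2 + (1 + t⁻¹) * ‖y‖ ^ 2 := by
    intro t ht
    have id1 : ∀ (s : ℝ) (z : τ.PreL2), 0 ≤ s → ‖(s : ℂ) • z‖ ^ 2 = s ^ 2 * ‖z‖ ^ 2 := by
      intro s z hs
      rw [preL2_norm_smul, mul_pow, Complex.norm_real, Real.norm_eq_abs, sq_abs]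
    have e : ENNReal.ofReal t * τ (star x.val * x.val) + ENNReal.ofReal t⁻¹ * τ (star y.val * y.val)
        + (τ (star x.val * x.val) + τ (star y.val * y.val)) =
        τ (star (x + y).val * (x + y).val) +
          ENNReal.ofReal t⁻¹ * τ (star ((t : ℂ) • x - y).val * ((t : ℂ) • x - y).val) := by
      have p := fun x : A => star_mul_self_nonneg x
      have hs : ∀ (s : ℝ) (z : A), 0 < s → ENNReal.ofReal s * τ (star z * z) =
          τ (s • (star z * z)) := by
        intro s z hs
        have := τ.map_smul' s.toNNReal _ (p z)
        rw [Real.coe_toNNReal _ hs.le] at this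
        rw [this]; rfl
      have q : ∀ (s : ℝ) (z : A), 0 < s → 0 ≤ s • (star z * z) :=
        fun s z hs => smul_nonneg hs.le (p z)
      have hti := inv_pos.2 ht
      rw [hs _ _ ht, hs _ _ hti, hs _ _ hti, ← τ.map_add' _ _ (q _ _ ht) (q _ _ hti),
        ← τ.map_add' _ _ (p _) (p _), ← τ.map_add' _ _ (p _) (q _ _ hti),
        ← τ.map_add' _ _ (add_nonneg (q _ _ ht) (q _ _ hti)) (add_nonneg (p _) (p _))]
      congr 1
      have e1 : (x + y).val = x.val + y.val := rfl
      have e2 : ((t : ℂ) • x - y).val = t • x.val - y.val := rfl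
      rw [e1, e2]
      simp only [star_add, star_sub, star_smul, add_mul, mul_add, sub_mul, mul_sub,
        smul_mul_assoc, mul_smul_comm, smul_sub, smul_smul, star_trivial]
      rw [inv_mul_cancel_left₀ ht.ne', inv_mul_cancel₀ ht.ne']
      module
    have e' := congrArg ENNReal.toReal e
    have fin := fun z : τ.PreL2 => (τ.preL2_lt_top z).ne
    have fin' : ∀ (s : ℝ) (z : τ.PreL2), ENNReal.ofReal s * τ (star z.val * z.val) ≠ ∞ :=
      fun s z => ENNReal.mul_ne_top ENNReal.ofReal_ne_top (fin z)
    rw [ENNReal.toReal_add (ENNReal.add_ne_top.2 ⟨fin' _ _, fin' _ _⟩)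
      (ENNReal.add_ne_top.2 ⟨fin _, fin _⟩), ENNReal.toReal_add (fin' _ _) (fin' _ _),
      ENNReal.toReal_add (fin _) (fin _), ENNReal.toReal_add (fin _) (fin' _ _)] at e'
    simp only [ENNReal.toReal_mul, ENNReal.toReal_ofReal ht.le,
      ENNReal.toReal_ofReal (inv_pos.2 ht).le, ← preL2_norm_sq] at e'
    have : 0 ≤ t⁻¹ * ‖(t : ℂ) • x - y‖ ^ 2 := by positivity
    nlinarith
  have hx := τ.preL2_norm_nonneg x
  have hy := τ.preL2_norm_nonneg y
  refine le_of_forall_pos_le_add fun ε hε => ?_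
  have hsq : ‖x + y‖ ^ 2 ≤ (‖x‖ + ‖y‖ + ε) ^ 2 := by
    have hX : 0 < ‖x‖ + ε / 2 := by linarith
    have hY : 0 < ‖y‖ + ε / 2 := by linarith
    have h := key ((‖y‖ + ε / 2) / (‖x‖ + ε / 2)) (div_pos hY hX)
    have h1 : ‖x‖ ^ 2 ≤ (‖x‖ + ε / 2) ^ 2 := by nlinarith
    have h2 : ‖y‖ ^ 2 ≤ (‖y‖ + ε / 2) ^ 2 := by nlinarith
    have p1 := div_pos hY hX
    have p2 := inv_pos.2 p1
    calc ‖x + y‖ ^ 2 ≤ _ := h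
      _ ≤ (1 + (‖y‖ + ε / 2) / (‖x‖ + ε / 2)) * (‖x‖ + ε / 2) ^ 2 +
          (1 + ((‖y‖ + ε / 2) / (‖x‖ + ε / 2))⁻¹) * (‖y‖ + ε / 2) ^ 2 := by gcongr
      _ = _ := by field_simp; ring
  exact (sq_le_sq₀ (τ.preL2_norm_nonneg _) (by linarith)).1 hsq

noncomputable instance : NormedAddCommGroup τ.PreL2 :=
  NormedAddCommGroup.ofCore (𝕜 := ℂ)
    { norm_nonneg := τ.preL2_norm_nonneg
      norm_smul := τ.preL2_norm_smul
      norm_triangle := τ.preL2_norm_add_le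
      norm_eq_zero_iff := fun x => by
        constructor
        · intro h
          have h2 := τ.preL2_norm_sq x
          rw [h, zero_pow two_ne_zero, eq_comm, ENNReal.toReal_eq_zero_iff] at h2
          have h3 := τ.faithful' _ (star_mul_self_nonneg _)
            (h2.resolve_right (τ.preL2_lt_top x).ne)
          exact Subtype.ext ((CStarRing.star_mul_self_eq_zero_iff _).1 h3)
        · rintro rfl
          have := τ.preL2_norm_smul 0 0
          simpa using this }

noncomputable instance : NormedSpace ℂ τ.PreL2 where
  norm_smul_le c x := (τ.preL2_norm_smul c x).le

/-- The inner product `(a, b)₂ = τ(a⋆b)`, given by polarization of `‖a‖₂² = τ(a⋆a)`. -/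
noncomputable instance : InnerProductSpace ℂ τ.PreL2 :=
  InnerProductSpace.ofNorm ℂ fun x y => by
    have := τ.preL2_parallelogram x y
    simpa only [sq] using this

/-- The Hilbert space `L²(A, τ)` of the GNS representation of `τ`: the completion of
`A ∩ L²(A, τ)` with respect to `‖a‖₂`. -/
abbrev L2 : Type _ := UniformSpace.Completion τ.PreL2

/-- The canonical embedding of `A ∩ L²(A, τ)` into `L²(A, τ)`. -/
noncomputable def toL2 : τ.sqIntegrable →ₗ[ℂ] τ.L2 :=
  (UniformSpace.Completion.toComplₗᵢ (𝕜 := ℂ) (E := τ.PreL2)).toLinearMap ∘ₗ τ.toPreL2.toLinearMap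

lemma norm_toL2_sq (a : τ.sqIntegrable) : ‖τ.toL2 a‖ ^ 2 = (τ (star (a : A) * a)).toReal := by
  have h := τ.preL2_norm_sq (τ.toPreL2 a)
  rw [← UniformSpace.Completion.norm_coe (τ.toPreL2 a)] at h
  exact h

lemma denseRange_toL2 : DenseRange τ.toL2 :=
  UniformSpace.Completion.denseRange_coe.comp τ.toPreL2.surjective.denseRange
    (UniformSpace.Completion.continuous_coe _)

/-- The involution `a ↦ a⋆` on `A ∩ L²(A, τ)`. -/
noncomputable def preJ (x : τ.PreL2) : τ.PreL2 := τ.toPreL2 ⟨star x.val, τ.star_mem (τ.toPreL2.symm x).2⟩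

lemma isometry_preJ : Isometry τ.preJ := by
  refine Isometry.of_dist_eq fun x y => ?_
  rw [dist_eq_norm, dist_eq_norm]
  have h : τ.preJ x - τ.preJ y = τ.preJ (x - y) :=
    Subtype.ext (star_sub x.val y.val).symm
  rw [h, ← sq_eq_sq₀ (norm_nonneg _) (norm_nonneg _), preL2_norm_sq, preL2_norm_sq,
    τ.tracial' (x - y).val]
  congr 2
  change star (star (x - y).val) * star (x - y).val = _
  rw [star_star]

/-- The modular conjugation `J`: the isometric extension of `a ↦ a⋆` to `L²(A, τ)`. -/
noncomputable def J : τ.L2 → τ.L2 := UniformSpace.Completion.map τ.preJ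

lemma J_toL2 (a : τ.sqIntegrable) : τ.J (τ.toL2 a) = τ.toL2 ⟨star (a : A), τ.star_mem a.2⟩ :=
  UniformSpace.Completion.map_coe τ.isometry_preJ.uniformContinuous _

lemma continuous_J : Continuous τ.J := UniformSpace.Completion.continuous_map

/-- The standard cone `L²₊(A, τ)`: the `L²`-closure of the positive square integrable elements. -/
def posCone : Set τ.L2 := closure (τ.toL2 '' {a | 0 ≤ (a : A)})

/-- The `L²`-closure of `{a ∈ A ∩ L²(A, τ) : a = a⋆, a ≤ 1}`. For self-adjoint `a` the condition
`a ≤ 1` says that the spectrum of `a` (in the unitization) lies in `(-∞, 1]`. -/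
def belowOne : Set τ.L2 :=
  closure (τ.toL2 '' {a | IsSelfAdjoint (a : A) ∧ ∀ x ∈ quasispectrum ℝ (a : A), x ≤ 1})

/-- `η` is the Hilbert projection `ξ ∧ 1` of the real vector `ξ` onto the closed convex set
`belowOne`. -/
def IsMeetOne (ξ η : τ.L2) : Prop :=
  η ∈ τ.belowOne ∧ ∀ ζ ∈ τ.belowOne, ‖ξ - η‖ ≤ ‖ξ - ζ‖

/-! Matrix amplification. `L²(𝕄ₙ(A), τₙ)`, with `τₙ = τ ⊗ trₙ`, consists of the `n × n` matrices
over `L²(A, τ)` with `‖ξ‖² = n⁻¹ ∑ᵢⱼ ‖ξᵢⱼ‖²`, and a matrix over `A` is `τₙ`-square integrable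
exactly when its entries are `τ`-square integrable. The factor `n⁻¹` does not affect closures
or nearest points and is omitted. -/

/-- The modular conjugation of `L²(𝕄ₙ(A), τₙ)`: `[ξᵢⱼ] ↦ [J ξⱼᵢ]`. -/
noncomputable def matJ {n : ℕ} (ξ : Matrix (Fin n) (Fin n) τ.L2) : Matrix (Fin n) (Fin n) τ.L2 :=
  ξ.transpose.map τ.J

/-- The analogue of `belowOne` for `(𝕄ₙ(A), τₙ)`. -/
def matBelowOne (n : ℕ) : Set (Matrix (Fin n) (Fin n) τ.L2) :=
  closure ((fun a : Matrix (Fin n) (Fin n) τ.sqIntegrable => a.map τ.toL2) ''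
    {a | IsSelfAdjoint (CStarMatrix.ofMatrix (a.map Subtype.val) : CStarMatrix (Fin n) (Fin n) A) ∧
      ∀ x ∈ quasispectrum ℝ
        (CStarMatrix.ofMatrix (a.map Subtype.val) : CStarMatrix (Fin n) (Fin n) A), x ≤ 1})

/-- The analogue of `IsMeetOne` for `(𝕄ₙ(A), τₙ)`. -/
def IsMatMeetOne {n : ℕ} (ξ η : Matrix (Fin n) (Fin n) τ.L2) : Prop :=
  η ∈ τ.matBelowOne n ∧ ∀ ζ ∈ τ.matBelowOne n,
    ∑ i, ∑ j, ‖ξ i j - η i j‖ ^ 2 ≤ ∑ i, ∑ j, ‖ξ i j - ζ i j‖ ^ 2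

end CStarTrace

/-- A closed, densely defined, nonnegative quadratic form `(𝓔, 𝓕)` on a complex Hilbert space,
given by its sesquilinear form (antilinear in the first variable). -/
structure ClosedForm (H : Type*) [NormedAddCommGroup H] [InnerProductSpace ℂ H] where
  /-- The domain `𝓕`. -/
  domain : Submodule ℂ H
  /-- The sesquilinear form `𝓔(ξ, η)`. -/
  form : domain →ₗ⋆[ℂ] domain →ₗ[ℂ] ℂ
  dense_domain : Dense (domain : Set H)
  hermitian : ∀ ξ η : domain, form ξ η = star (form η ξ)
  nonneg : ∀ ξ : domain, 0 ≤ form ξ ξ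
  closed : ∀ (u : ℕ → domain) (ξ : H),
    Filter.Tendsto (fun k => (u k : H)) Filter.atTop (nhds ξ) →
    (∀ ε > 0, ∃ N, ∀ k ≥ N, ∀ l ≥ N, (form (u k - u l) (u k - u l)).re < ε) →
    ∃ η : domain, (η : H) = ξ ∧
      Filter.Tendsto (fun k => (form (u k - η) (u k - η)).re) Filter.atTop (nhds 0)

namespace ClosedForm

variable {H : Type*} [NormedAddCommGroup H] [InnerProductSpace ℂ H] (E : ClosedForm H)

/-- The quadratic form `𝓔[ξ] = 𝓔(ξ, ξ)`. -/
def energy (ξ : E.domain) : ℝ := (E.form ξ ξ).re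

/-- The scalar product `⟨ξ, η⟩_𝓕 = 𝓔(ξ, η) + (ξ, η)` of the Dirichlet space. -/
noncomputable def innerF (ξ η : E.domain) : ℂ := E.form ξ η + inner ℂ (ξ : H) (η : H)

/-- The graph norm `‖ξ‖_𝓕 = (𝓔[ξ] + ‖ξ‖²)^{1/2}`. -/
noncomputable def normF (ξ : E.domain) : ℝ := √(E.energy ξ + ‖(ξ : H)‖ ^ 2)

lemma energy_nonneg (ξ : E.domain) : 0 ≤ E.energy ξ := (Complex.nonneg_iff.1 (E.nonneg ξ)).1

lemma normF_sq (ξ : E.domain) : E.normF ξ ^ 2 = E.energy ξ + ‖(ξ : H)‖ ^ 2 :=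
  Real.sq_sqrt (add_nonneg (E.energy_nonneg ξ) (sq_nonneg _))

lemma innerF_self (ξ : E.domain) : E.innerF ξ ξ = ((E.normF ξ ^ 2 : ℝ) : ℂ) := by
  rw [normF_sq, innerF, inner_self_eq_norm_sq_to_K]
  have h := (Complex.nonneg_iff.1 (E.nonneg ξ)).2
  apply Complex.ext <;> simp [energy, ← Complex.ofReal_pow, ← h]

end ClosedForm

section DirichletForms

variable {A : Type*} [NonUnitalCStarAlgebra A] [PartialOrder A] [StarOrderedRing A]

/-- A C⋆-Dirichlet form on `L²(A, τ)`: a closed, densely defined, nonnegative quadratic form that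
is real, Markovian, completely Dirichlet and regular. -/
structure CStarDirichletForm (τ : CStarTrace A) extends ClosedForm τ.L2 where
  /-- Reality: `J ξ ∈ 𝓕` and `𝓔[J ξ] = 𝓔[ξ]` for `ξ ∈ 𝓕`. -/
  real : ∀ ξ : domain, ∃ h : τ.J ξ ∈ domain,
    (form ⟨τ.J ξ, h⟩ ⟨τ.J ξ, h⟩).re = (form ξ ξ).re
  /-- Markovianity: `ξ ∧ 1 ∈ 𝓕` and `𝓔[ξ ∧ 1] ≤ 𝓔[ξ]` for real `ξ ∈ 𝓕`. -/
  markovian : ∀ ξ : domain, τ.J ξ = ξ → ∀ η : τ.L2, τ.IsMeetOne ξ η →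
    ∃ h : η ∈ domain, (form ⟨η, h⟩ ⟨η, h⟩).re ≤ (form ξ ξ).re
  /-- All amplifications `𝓔ₙ[[ξᵢⱼ]] = ∑ᵢⱼ 𝓔[ξᵢⱼ]` on `𝕄ₙ(𝓕)` are real ... -/
  completely_real : ∀ n : ℕ, 1 ≤ n → ∀ ξ : Matrix (Fin n) (Fin n) domain,
    ∃ h : ∀ i j, τ.matJ (ξ.map Subtype.val) i j ∈ domain,
      ∑ i, ∑ j, (form ⟨_, h i j⟩ ⟨_, h i j⟩).re = ∑ i, ∑ j, (form (ξ i j) (ξ i j)).re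
  /-- ... and Markovian. -/
  completely_markovian : ∀ n : ℕ, 1 ≤ n → ∀ ξ : Matrix (Fin n) (Fin n) domain,
    τ.matJ (ξ.map Subtype.val) = ξ.map Subtype.val →
    ∀ η : Matrix (Fin n) (Fin n) τ.L2, τ.IsMatMeetOne (ξ.map Subtype.val) η →
    ∃ h : ∀ i j, η i j ∈ domain,
      ∑ i, ∑ j, (form ⟨_, h i j⟩ ⟨_, h i j⟩).re ≤ ∑ i, ∑ j, (form (ξ i j) (ξ i j)).re
  /-- Regularity, first half: `𝓑 = A ∩ 𝓕` is norm dense in `A`. -/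
  dense_in_algebra : Dense {a : A | ∃ h : a ∈ τ.sqIntegrable, τ.toL2 ⟨a, h⟩ ∈ domain}
  /-- Regularity, second half: `𝓑` is dense in `𝓕` for the graph norm. -/
  core : ∀ ξ : domain, ∀ ε > 0, ∃ (b : τ.sqIntegrable) (h : τ.toL2 b ∈ domain),
    toClosedForm.normF (ξ - ⟨τ.toL2 b, h⟩) < ε

/-- The positive functionals `A⋆₊`. -/
def IsPositiveFunctional (ω : StrongDual ℂ A) : Prop := ∀ a : A, 0 ≤ a → 0 ≤ ω a

/-- The order `ω' ≤ ω` of functionals. -/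
def FunctionalLE (ω' ω : StrongDual ℂ A) : Prop := ∀ a : A, 0 ≤ a → ω' a ≤ ω a

namespace CStarDirichletForm

variable {τ : CStarTrace A} (D : CStarDirichletForm τ)

/-- The Dirichlet algebra `𝓑 = A ∩ 𝓕`. -/
noncomputable def algebraB : Submodule ℂ τ.sqIntegrable := D.domain.comap τ.toL2

/-- An element of `𝓑` as an element of `𝓕`. -/
noncomputable def toF (b : D.algebraB) : D.domain := ⟨τ.toL2 b, b.2⟩

/-- An element of `𝓑` as an element of `A`. -/
noncomputable def toA (b : D.algebraB) : A := ((b : τ.sqIntegrable) : A)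

/-- `𝓕₊ = 𝓕 ∩ L²₊(A, τ)`. -/
def posF : Set D.domain := {ξ | (ξ : τ.L2) ∈ τ.posCone}

/-- `ω` has finite energy: `ω(b) ≤ c ‖b‖_𝓕` for all `b ∈ 𝓑₊ = 𝓑 ∩ L²₊(A, τ)`, for some `c ≥ 0`.
For a positive functional the values `ω(b)`, `b ∈ 𝓑₊`, are real. -/
def HasFiniteEnergy (ω : StrongDual ℂ A) : Prop :=
  ∃ c : ℝ, 0 ≤ c ∧ ∀ b : D.algebraB, D.toF b ∈ D.posF → (ω (D.toA b)).re ≤ c * D.normF (D.toF b)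

/-- `ξ ∈ 𝓕` is a potential associated with `ω`: `ω(b) = ⟨ξ, b⟩_𝓕` for all `b ∈ 𝓑`. -/
def IsPotentialOf (ω : StrongDual ℂ A) (ξ : D.domain) : Prop :=
  ∀ b : D.algebraB, ω (D.toA b) = D.innerF ξ (D.toF b)

open Classical in
/-- The potential `G(ω)`, the element of `𝓕` with `ω(b) = ⟨G(ω), b⟩_𝓕` for all `b ∈ 𝓑`
(and `0` if there is none). -/
noncomputable def potential (ω : StrongDual ℂ A) : D.domain :=
  if h : ∃ ξ, D.IsPotentialOf ω ξ then h.choose else 0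

/-- The energy content `𝓔[ω] = ω(G(ω))`, where `ω` is extended to `𝓕` by
`ω(ξ) = ⟨G(ω), ξ⟩_𝓕`; it is the squared graph norm of `G(ω)`. -/
noncomputable def energyContent (ω : StrongDual ℂ A) : ℝ :=
  (D.innerF (D.potential ω) (D.potential ω)).re

end CStarDirichletForm

end DirichletForms

/-! The potential of a positive functional `ω` minimises `‖v‖² - 2 Re ω(v)` in the graph norm, up to
the constant `‖G(ω)‖²`. Replacing an element of `𝓑` by the positive part of its real part does not
increase the graph norm and does not decrease `Re ω`, so it brings the element no farther from
`G(ω)`. Hence `G(ω)` is a graph-norm limit of positive elements of `𝓑`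
(`IsPotentialOf.exists_pos_norm_sub_lt`); in particular it lies in the cone, and two such potentials
have nonnegative real inner product. Since `G(ω) - G(ω')` is the potential of the positive
functional `ω - ω'`, this gives the order relation, and expanding `‖G(ω') + (G(ω) - G(ω'))‖²` gives
the energy inequality.

The contraction property comes from Markovianity. For self-adjoint `b`, `isMeetOne_trunc` identifies
the abstract projection `b ∧ 1` with functional calculus; scaling gives `b ∧ ε`, and as `ε → 0`
closedness of the form puts `b ∧ 0 = -b₋` in `𝓑` (`truncZero_mem`). The same decomposition turns
finite energy into a bound on all of `𝓑`, so the Riesz theorem yields potentials.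

Passing from `ω` to `ω'` needs `𝓑₊` to consist of positive elements of `A`, although `𝓑₊` is defined
through an `L²`-closure: this is `nonneg_of_toL2_mem_posCone`. -/

lemma star_cfcₙ_mul_self {A : Type*} [NonUnitalCStarAlgebra A] (f : ℝ → ℝ) (b : A)
    (hf : Continuous f) (f0 : f 0 = 0) :
    star (cfcₙ f b) * cfcₙ f b = cfcₙ (fun x => f x * f x) b := by
  rw [(cfcₙ_predicate f b).star_eq, cfcₙ_mul f f b hf.continuousOn f0 hf.continuousOn f0]

/-! ### Inner products in `L²` expressed through the trace of positive elements -/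

namespace CStarTrace

variable {A : Type*} [NonUnitalCStarAlgebra A] [PartialOrder A] [StarOrderedRing A]
  (τ : CStarTrace A)

lemma mono {a b : A} (ha : 0 ≤ a) (hab : a ≤ b) : τ a ≤ τ b := by
  have h := τ.map_add' a (b - a) ha (sub_nonneg.2 hab)
  rw [add_sub_cancel] at h
  exact h ▸ le_self_add

lemma map_real_smul {r : ℝ} (hr : 0 ≤ r) {a : A} (ha : 0 ≤ a) :
    τ (r • a) = ENNReal.ofReal r * τ a := by
  have := τ.map_smul' r.toNNReal a ha
  rwa [Real.coe_toNNReal _ hr] at this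

lemma lt_top_of_le_smul {a b : A} {r : ℝ} (hr : 0 ≤ r) (ha : 0 ≤ a) (hb : 0 ≤ b)
    (hab : a ≤ r • b) (h : τ b < ∞) : τ a < ∞ := by
  refine (τ.mono ha hab).trans_lt ?_
  rw [τ.map_real_smul hr hb]
  exact ENNReal.mul_lt_top ENNReal.ofReal_lt_top h

lemma mul_self_lt_top {s : A} (hs : IsSelfAdjoint s) (h : τ (s * s) < ∞) :
    τ (s * s * (s * s)) < ∞ := by
  have hp : IsSelfAdjoint (s * s) := hs.commute_iff hs |>.1 (Commute.refl s)
  refine τ.lt_top_of_le_smul (norm_nonneg (s * s)) hp.mul_self_nonneg hs.mul_self_nonneg ?_ h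
  have := CStarAlgebra.star_left_conjugate_le_norm_smul (a := s) hp
  rw [hs.star_eq] at this
  convert this using 1
  noncomm_ring

lemma conjugate_lt_top {p c : A} (hp : IsSelfAdjoint p) (hc : IsSelfAdjoint c) (hp0 : 0 ≤ p)
    (h : τ (c * c) < ∞) : τ (c * p * c) < ∞ := by
  refine τ.lt_top_of_le_smul (norm_nonneg p) (hc.conjugate_nonneg hp0) hc.mul_self_nonneg ?_ h
  have := CStarAlgebra.star_left_conjugate_le_norm_smul (a := c) hp
  rwa [hc.star_eq] at this

/-- Morally `Re τ(s²c) = τ(scs)`, but `τ` is defined and additive only on positive elements. With `z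
= s - sc`, the square of `s² + c` is expanded through `z⋆z` and `s² - scs` through `zz⋆`; traciality
equates `τ(z⋆z)` with `τ(zz⋆)`, which is then eliminated. -/
lemma polarization_of_conjugate_le {s c : A} (hs : IsSelfAdjoint s) (hc : IsSelfAdjoint c)
    (hsf : τ (s * s) < ∞) (hcf : τ (c * c) < ∞) (h : s * c * s ≤ s * s) :
    (τ ((s * s + c) * (s * s + c))).toReal + 2 * (τ (s * s - s * c * s)).toReal =
      (τ (s * s * (s * s))).toReal + (τ (c * c)).toReal + 2 * (τ (s * s)).toReal := by
  have hp : IsSelfAdjoint (s * s) := hs.commute_iff hs |>.1 (Commute.refl s)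
  have hp0 : 0 ≤ s * s := hs.mul_self_nonneg
  have hcpc : 0 ≤ c * (s * s) * c := hc.conjugate_nonneg hp0
  have hd : 0 ≤ s * s - s * c * s := sub_nonneg.2 h
  have hz := star_mul_self_nonneg (s - s * c)
  have hz' := mul_star_self_nonneg (s - s * c)
  have fpp := τ.mul_self_lt_top hs hsf
  have fcpc := τ.conjugate_lt_top hp hc hp0 hcf
  have e1 : (s * s + c) * (s * s + c) + star (s - s * c) * (s - s * c) =
      s * s * (s * s) + c * c + s * s + c * (s * s) * c := by
    simp only [star_sub, star_mul, hs.star_eq, hc.star_eq]; noncomm_ring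
  have e2 : (s - s * c) * star (s - s * c) + s * s =
      (s * s - s * c * s) + (s * s - s * c * s) + (s * c) * star (s * c) := by
    simp only [star_sub, star_mul, hs.star_eq, hc.star_eq]; noncomm_ring
  have t3 : τ ((s * c) * star (s * c)) = τ (c * (s * s) * c) := by
    rw [← τ.tracial']
    simp only [star_mul, hs.star_eq, hc.star_eq, mul_assoc]
  have h1 := congrArg τ e1
  rw [τ.map_add' _ _ (hp.add hc).mul_self_nonneg hz,
    τ.map_add' _ _ (add_nonneg (add_nonneg hp.mul_self_nonneg hc.mul_self_nonneg) hp0) hcpc,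
    τ.map_add' _ _ (add_nonneg hp.mul_self_nonneg hc.mul_self_nonneg) hp0,
    τ.map_add' _ _ hp.mul_self_nonneg hc.mul_self_nonneg] at h1
  have h2 := congrArg τ e2
  rw [τ.map_add' _ _ hz' hp0, τ.map_add' _ _ (add_nonneg hd hd) (mul_star_self_nonneg _),
    τ.map_add' _ _ hd hd, t3, ← τ.tracial'] at h2
  have r1 : τ (s * s * (s * s)) + τ (c * c) + τ (s * s) + τ (c * (s * s) * c) < ∞ := by
    simp [ENNReal.add_lt_top, *]
  have l1 := h1 ▸ r1
  rw [ENNReal.add_lt_top] at l1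
  have l2 : τ (star (s - s * c) * (s - s * c)) + τ (s * s) < ∞ :=
    ENNReal.add_lt_top.2 ⟨l1.2, hsf⟩
  rw [h2, ENNReal.add_lt_top, ENNReal.add_lt_top] at l2
  have k1 := congrArg ENNReal.toReal h1
  have k2 := congrArg ENNReal.toReal h2
  rw [ENNReal.toReal_add l1.1.ne l1.2.ne, ENNReal.toReal_add (by finiteness) (by finiteness),
    ENNReal.toReal_add (by finiteness) (by finiteness),
    ENNReal.toReal_add (by finiteness) (by finiteness)] at k1
  rw [ENNReal.toReal_add l1.2.ne hsf.ne,
    ENNReal.toReal_add (ENNReal.add_ne_top.2 ⟨l2.1.1.ne, l2.1.1.ne⟩) fcpc.ne,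
    ENNReal.toReal_add l2.1.1.ne l2.1.1.ne] at k2
  linarith

/-- The value is `τ(scs)`, written as a difference because `scs` need not be positive whereas `p -
scs` is. -/
lemma re_inner_toL2 {s : A} {p c : τ.sqIntegrable} (hs : IsSelfAdjoint s) (hp : (p : A) = s * s)
    (hc : IsSelfAdjoint (c : A)) (hsf : τ (p : A) < ∞) (h : s * c * s ≤ p) :
    (inner ℂ (τ.toL2 p) (τ.toL2 c)).re = (τ (p : A)).toReal - (τ ((p : A) - s * c * s)).toReal := by
  have hcf : τ ((c : A) * c) < ∞ := by
    have := c.2; change τ (star (c : A) * c) < ∞ at this; rwa [hc.star_eq] at this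
  have hsa : IsSelfAdjoint (s * s) := hs.commute_iff hs |>.1 (Commute.refl s)
  have key := τ.polarization_of_conjugate_le hs hc (hp ▸ hsf) hcf (hp ▸ h)
  have e := norm_add_sq (𝕜 := ℂ) (τ.toL2 p) (τ.toL2 c)
  rw [← map_add, norm_toL2_sq, norm_toL2_sq, norm_toL2_sq, Submodule.coe_add, hp, star_add,
    hsa.star_eq, hc.star_eq] at e
  rw [hp]
  simp only [RCLike.re_to_complex] at e
  linarith

lemma toL2_injective : Function.Injective τ.toL2 :=
  (UniformSpace.Completion.coe_injective _).comp τ.toPreL2.injective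

section FunctionalCalculus

variable {b : A} {f g : ℝ → ℝ}

lemma trace_cfcₙ_sq_le (hb : IsSelfAdjoint b) (hf : Continuous f) (f0 : f 0 = 0)
    (h : ∀ x, |f x| ≤ |x|) : τ (star (cfcₙ f b) * cfcₙ f b) ≤ τ (star b * b) := by
  have e : star b * b = cfcₙ (fun x : ℝ => x * x) b := by
    rw [hb.star_eq, cfcₙ_mul (fun x : ℝ => x) (fun x : ℝ => x) b, cfcₙ_id' ℝ b]
  rw [e, star_cfcₙ_mul_self f b hf f0]
  refine τ.mono (cfcₙ_nonneg fun x _ => mul_self_nonneg _) (cfcₙ_mono (fun x _ => ?_)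
    (by fun_prop) (by fun_prop) (by simp [f0]) (by simp))
  exact abs_le_iff_mul_self_le.1 (h x)

lemma cfcₙ_mem_sqIntegrable (hb : IsSelfAdjoint b) (hbs : b ∈ τ.sqIntegrable) (hf : Continuous f)
    (f0 : f 0 = 0) (h : ∀ x, |f x| ≤ |x|) : cfcₙ f b ∈ τ.sqIntegrable :=
  (τ.trace_cfcₙ_sq_le hb hf f0 h).trans_lt hbs

lemma trace_cfcₙ_lt_top (hb : IsSelfAdjoint b) (hbs : b ∈ τ.sqIntegrable) (hf : Continuous f)
    (f0 : f 0 = 0) (hf' : ∀ x, 0 ≤ f x) {r : ℝ} (hr : 0 ≤ r) (h : ∀ x, f x ≤ r * (x * x)) :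
    τ (cfcₙ f b) < ∞ := by
  refine τ.lt_top_of_le_smul hr (cfcₙ_nonneg fun x _ => hf' x) (star_mul_self_nonneg b) ?_ hbs
  have e : star b * b = cfcₙ (fun x : ℝ => x * x) b := by
    rw [hb.star_eq, cfcₙ_mul (fun x : ℝ => x) (fun x : ℝ => x) b, cfcₙ_id' ℝ b]
  rw [e, ← cfcₙ_const_mul r (fun x => x * x) b]
  exact cfcₙ_mono (fun x _ => h x) (by fun_prop) (by fun_prop) (by simp [f0]) (by simp)

end FunctionalCalculus

end CStarTrace

lemma cfcₙ_sqrt_mul_self {A : Type*} [NonUnitalCStarAlgebra A]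
    {f : ℝ → ℝ} (b : A) (hf : Continuous f) (f0 : f 0 = 0) (hf' : ∀ x, 0 ≤ f x) :
    cfcₙ f b = cfcₙ (fun x => √(f x)) b * cfcₙ (fun x => √(f x)) b := by
  rw [← cfcₙ_mul _ _ b (by fun_prop) (by simp [f0]) (by fun_prop) (by simp [f0])]
  congr 1; ext x; exact (Real.mul_self_sqrt (hf' x)).symm

/-- In place of a unit, `c` is bounded by its positive part, which has norm at most `1`. -/
lemma IsSelfAdjoint.conjugate_le_of_quasispectrum_le_one {A : Type*} [NonUnitalCStarAlgebra A]
    [PartialOrder A] [StarOrderedRing A] {s c : A} (hs : IsSelfAdjoint s) (hc : IsSelfAdjoint c)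
    (h : ∀ x ∈ quasispectrum ℝ c, x ≤ 1) : s * c * s ≤ s * s := by
  have h1 : c ≤ cfcₙ (fun x : ℝ => max x 0) c := by
    conv_lhs => rw [← cfcₙ_id' ℝ c]
    exact cfcₙ_mono fun x _ => le_max_left _ _
  have h2 : ‖cfcₙ (fun x : ℝ => max x 0) c‖ ≤ 1 := norm_cfcₙ_le fun x hx => by
    rw [Real.norm_of_nonneg (le_max_right _ _)]; exact max_le (h x hx) zero_le_one
  have h3 := star_left_conjugate_le_conjugate h1 s
  have h4 := CStarAlgebra.star_left_conjugate_le_norm_smul (a := s)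
    (cfcₙ_predicate (fun x : ℝ => max x 0) c : IsSelfAdjoint _)
  rw [hs.star_eq] at h3 h4
  refine h3.trans (h4.trans ?_)
  calc _ ≤ (1 : ℝ) • (s * s) := smul_le_smul_of_nonneg_right h2 hs.mul_self_nonneg
    _ = _ := one_smul _ _

namespace CStarTrace

variable {A : Type*} [NonUnitalCStarAlgebra A] [PartialOrder A] [StarOrderedRing A]
  (τ : CStarTrace A)

lemma map_zero : τ (0 : A) = 0 := by
  simpa using τ.map_smul' 0 (0 : A) le_rfl

/-- Monotonicity survives `toReal` only if the larger trace is finite; here it is dominated by `(1 +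
‖d‖) s²`. -/
lemma toReal_sub_conjugate_mono {s c d : A} (hs : IsSelfAdjoint s) (hd : IsSelfAdjoint d)
    (hsf : τ (s * s) < ∞) (hc : 0 ≤ c) (h : c ≤ s * s - s * d * s) :
    (τ c).toReal ≤ (τ (s * s - s * d * s)).toReal := by
  refine ENNReal.toReal_mono (ne_of_lt ?_) (τ.mono hc h)
  refine τ.lt_top_of_le_smul (r := 1 + ‖d‖) (by positivity) (hc.trans h) hs.mul_self_nonneg ?_ hsf
  have := CStarAlgebra.star_left_conjugate_le_norm_smul (a := s) hd.neg
  rw [hs.star_eq, norm_neg] at this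
  rw [add_smul, one_smul, sub_eq_add_neg]
  gcongr
  convert this using 1
  noncomm_ring

/-- The real part of `(f(b), c)₂` for `0 ≤ f ≤ |x|` and `f ≤ r x²`, where `f(b)` has finite trace. -/
lemma re_inner_cfcₙ {f : ℝ → ℝ} {b : A} (hb : IsSelfAdjoint b) (hbs : b ∈ τ.sqIntegrable)
    (hf : Continuous f) (f0 : f 0 = 0) (hf0 : ∀ x, 0 ≤ f x) (hf1 : ∀ x, |f x| ≤ |x|) {r : ℝ}
    (hr : 0 ≤ r) (hf2 : ∀ x, f x ≤ r * (x * x)) {c : τ.sqIntegrable} (hc : IsSelfAdjoint (c : A))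
    (h : cfcₙ (fun x => √(f x)) b * c * cfcₙ (fun x => √(f x)) b ≤ cfcₙ f b) :
    (inner ℂ (τ.toL2 ⟨cfcₙ f b, τ.cfcₙ_mem_sqIntegrable hb hbs hf f0 hf1⟩) (τ.toL2 c)).re =
      (τ (cfcₙ f b)).toReal -
        (τ (cfcₙ f b - cfcₙ (fun x => √(f x)) b * c * cfcₙ (fun x => √(f x)) b)).toReal :=
  τ.re_inner_toL2 (p := ⟨cfcₙ f b, _⟩) (cfcₙ_predicate _ b) (cfcₙ_sqrt_mul_self b hf f0 hf0) hc
    (τ.trace_cfcₙ_lt_top hb hbs hf f0 hf0 hr hf2) h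

/-! ### Truncations, and the projection onto `belowOne` -/

lemma abs_min_le {x ε : ℝ} (hε : 0 ≤ ε) : |min x ε| ≤ |x| := by
  rcases le_total x ε with h | h
  · rw [min_eq_left h]
  · rw [min_eq_right h, abs_of_nonneg hε]; exact h.trans (le_abs_self x)

lemma abs_max_sub_le {x ε : ℝ} (hε : 0 ≤ ε) : |max (x - ε) 0| ≤ |x| := by
  rw [abs_of_nonneg (le_max_right _ _)]
  exact max_le (by linarith [le_abs_self x]) (abs_nonneg x)

/-- A Chebyshev-type bound: it gives `(b - ε)₊` finite trace when `b` is merely square integrable.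
-/
lemma max_sub_le_mul {x ε : ℝ} (hε : 0 < ε) : max (x - ε) 0 ≤ ε⁻¹ * (x * x) := by
  refine max_le ?_ (by have := mul_self_nonneg x; positivity)
  rw [inv_mul_eq_div, le_div_iff₀ hε]
  nlinarith [sq_nonneg (x - ε)]

/-- The truncation `b ∧ ε`. -/
noncomputable def trunc (b : τ.sqIntegrable) (hb : IsSelfAdjoint (b : A)) (ε : ℝ) (hε : 0 ≤ ε) :
    τ.sqIntegrable :=
  ⟨cfcₙ (fun x => min x ε) (b : A), τ.cfcₙ_mem_sqIntegrable hb b.2 (by fun_prop)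
    (min_eq_left hε) fun _ => abs_min_le hε⟩

/-- Write `b = p + q` with `p = (b - 1)₊` and `q = b ∧ 1`. Every competitor `c ≤ 1` satisfies `Re
(p, c) ≤ τ(p) = Re (p, q)`, which is the variational inequality characterising the projection. -/
lemma isMeetOne_trunc (b : τ.sqIntegrable) (hb : IsSelfAdjoint (b : A)) :
    τ.IsMeetOne (τ.toL2 b) (τ.toL2 (τ.trunc b hb 1 zero_le_one)) := by
  set q := τ.trunc b hb 1 zero_le_one with hq
  have hqsa : IsSelfAdjoint (q : A) := cfcₙ_predicate _ _
  have fc : Continuous fun x : ℝ => max (x - 1) 0 := by fun_prop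
  have f0 : max ((0 : ℝ) - 1) 0 = 0 := by norm_num
  have hf1 : ∀ x : ℝ, |max (x - 1) 0| ≤ |x| := fun x => abs_max_sub_le zero_le_one
  set s := cfcₙ (fun x : ℝ => √(max (x - 1) 0)) (b : A) with hs
  have hssa : IsSelfAdjoint s := cfcₙ_predicate _ _
  have hp := cfcₙ_sqrt_mul_self (b : A) fc f0 fun x => le_max_right _ _
  have hsf : τ (s * s) < ∞ := by
    rw [hs, ← hp]
    exact τ.trace_cfcₙ_lt_top hb b.2 fc f0 (fun x => le_max_right _ _) (inv_nonneg.2 zero_le_one)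
      fun x => max_sub_le_mul one_pos
  have key := fun (c : τ.sqIntegrable) hc h => τ.re_inner_cfcₙ (c := c) hb b.2 fc f0
    (fun x => le_max_right _ _) hf1 (inv_nonneg.2 zero_le_one) (fun x => max_sub_le_mul one_pos) hc h
  set p : τ.sqIntegrable := ⟨_, τ.cfcₙ_mem_sqIntegrable hb b.2 fc f0 hf1⟩ with hpdef
  have hbpq : b = p + q := by
    refine Subtype.ext ?_
    change (b : A) = cfcₙ _ _ + cfcₙ _ _
    rw [← cfcₙ_add (fun x : ℝ => max (x - 1) 0) (fun x : ℝ => min x 1) (b : A) (by fun_prop) f0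
      (by fun_prop) (by norm_num)]
    conv_lhs => rw [← cfcₙ_id' ℝ (b : A)]
    congr 1; ext x
    rcases le_total x 1 with h | h
    · rw [max_eq_right (by linarith), min_eq_left h, zero_add]
    · rw [max_eq_left (by linarith), min_eq_right h]; ring
  -- Where `(x - 1)₊` is nonzero, `min x 1` equals `1`; thus `q` attains the upper bound for `Re (p,
  -- ·)`.
  have hsqs : s * q * s = cfcₙ (fun x : ℝ => max (x - 1) 0) (b : A) := by
    change s * cfcₙ _ _ * s = _
    rw [hs, ← cfcₙ_mul _ _ (b : A) (by fun_prop) (by norm_num) (by fun_prop) (by norm_num),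
      ← cfcₙ_mul _ _ (b : A) (by fun_prop) (by norm_num) (by fun_prop) (by norm_num)]
    congr 1; ext x
    rcases le_total x 1 with h | h
    · rw [max_eq_right (by linarith)]; simp
    · rw [min_eq_right h, mul_one]; exact Real.mul_self_sqrt (le_max_right _ _)
  have hpq := key q hqsa hsqs.le
  rw [hsqs, sub_self, map_zero, ENNReal.toReal_zero, sub_zero] at hpq
  refine ⟨subset_closure ⟨q, ⟨hqsa, ?_⟩, rfl⟩, ?_⟩
  · intro x hx
    change x ∈ quasispectrum ℝ (cfcₙ _ _) at hx
    rw [cfcₙ_map_quasispectrum _ _ (by fun_prop) (by norm_num) hb] at hx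
    obtain ⟨y, -, rfl⟩ := hx
    exact min_le_right _ _
  · refine fun ζ hζ => closure_minimal (t := {ζ | ‖τ.toL2 b - τ.toL2 q‖ ≤ ‖τ.toL2 b - ζ‖}) ?_
      (isClosed_le (by fun_prop) (by fun_prop)) hζ
    rintro _ ⟨c, ⟨hc, hc1⟩, rfl⟩
    have hscs : s * c * s ≤ cfcₙ (fun x : ℝ => max (x - 1) 0) (b : A) := by
      rw [hp]; exact hssa.conjugate_le_of_quasispectrum_le_one hc hc1
    have hpc := key c hc hscs
    have hle : (inner ℂ (τ.toL2 p) (τ.toL2 c)).re ≤ (inner ℂ (τ.toL2 p) (τ.toL2 q)).re := by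
      rw [hpc, hpq]; exact sub_le_self _ ENNReal.toReal_nonneg
    have e1 : τ.toL2 b - τ.toL2 q = τ.toL2 p := by rw [hbpq, map_add]; abel
    have e2 : τ.toL2 b - τ.toL2 c = τ.toL2 p + (τ.toL2 q - τ.toL2 c) := by rw [hbpq, map_add]; abel
    change ‖_‖ ≤ ‖_‖
    rw [← sq_le_sq₀ (norm_nonneg _) (norm_nonneg _), e1, e2, norm_add_sq (𝕜 := ℂ), inner_sub_right,
      RCLike.re_to_complex, Complex.sub_re]
    nlinarith [sq_nonneg ‖τ.toL2 q - τ.toL2 c‖]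

/-- Pointwise, `(min x ε - min x 0)² + ((x - ε)₊)² ≤ (x₊)²`. So the squared `L²`-distance is at most
the defect `τ(b₊²) - τ((b - ε)₊²)`, which tends to `0` because `(b - ε)₊ → b₊` in the norm of `A`
and `τ` is lower semicontinuous. -/
lemma tendsto_toL2_trunc (b : τ.sqIntegrable) (hb : IsSelfAdjoint (b : A)) {u : ℕ → ℝ}
    (hu : ∀ n, 0 ≤ u n) (hu0 : Filter.Tendsto u Filter.atTop (nhds 0)) :
    Filter.Tendsto (fun n => τ.toL2 (τ.trunc b hb (u n) (hu n))) Filter.atTop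
      (nhds (τ.toL2 (τ.trunc b hb 0 le_rfl))) := by
  have fc : ∀ ε : ℝ, Continuous fun x : ℝ => max (x - ε) 0 := fun ε => by fun_prop
  have f0 : ∀ n, max ((0 : ℝ) - u n) 0 = 0 := fun n => max_eq_right (by linarith [hu n])
  set P : ℕ → A := fun n => cfcₙ (fun x : ℝ => max (x - u n) 0) (b : A) with hP
  set Q : A := cfcₙ (fun x : ℝ => max x 0) (b : A) with hQ
  have hPQ : Filter.Tendsto P Filter.atTop (nhds Q) := by
    rw [tendsto_iff_norm_sub_tendsto_zero]
    refine squeeze_zero (fun n => norm_nonneg _) (fun n => ?_) hu0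
    change ‖cfcₙ _ _ - cfcₙ _ _‖ ≤ u n
    rw [← cfcₙ_sub (fun x : ℝ => max (x - u n) 0) (fun x : ℝ => max x 0) (b : A) (by fun_prop)
      (f0 n) (by fun_prop) (by simp)]
    refine norm_cfcₙ_le fun x _ => ?_
    rw [Real.norm_eq_abs]
    have := abs_max_sub_max_le_abs (x - u n) x 0
    rwa [sub_sub_cancel_left, abs_neg, abs_of_nonneg (hu n)] at this
  have hQs : τ (star Q * Q) < ∞ := τ.cfcₙ_mem_sqIntegrable hb b.2 (by fun_prop) (by simp)
    fun x => by simpa using abs_max_sub_le (x := x) le_rfl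
  have bound : ∀ n, ‖τ.toL2 (τ.trunc b hb (u n) (hu n)) - τ.toL2 (τ.trunc b hb 0 le_rfl)‖ ^ 2 ≤
      (τ (star Q * Q)).toReal - (τ (star (P n) * P n)).toReal := by
    intro n
    rw [← map_sub, norm_toL2_sq]
    have e : ((τ.trunc b hb (u n) (hu n) - τ.trunc b hb 0 le_rfl : τ.sqIntegrable) : A) =
        cfcₙ (fun x : ℝ => min x (u n) - min x 0) (b : A) := by
      rw [cfcₙ_sub (fun x : ℝ => min x (u n)) (fun x : ℝ => min x 0) (b : A) (by fun_prop)
        (min_eq_left (hu n)) (by fun_prop) (by simp)]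
      rfl
    have g0 : min (0 : ℝ) (u n) - min 0 0 = 0 := by simp [min_eq_left (hu n)]
    have e' : star (P n) * P n = cfcₙ (fun x : ℝ => max (x - u n) 0 * max (x - u n) 0) (b : A) :=
      star_cfcₙ_mul_self _ _ (fc _) (f0 n)
    rw [e, e', star_cfcₙ_mul_self _ _ (by fun_prop) g0]
    have h1 : τ (cfcₙ (fun x : ℝ => (min x (u n) - min x 0) * (min x (u n) - min x 0)) (b : A)) +
        τ (cfcₙ (fun x : ℝ => max (x - u n) 0 * max (x - u n) 0) (b : A)) ≤ τ (star Q * Q) := by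
      rw [← τ.map_add' _ _ (cfcₙ_nonneg fun x _ => mul_self_nonneg _)
        (cfcₙ_nonneg fun x _ => mul_self_nonneg _),
        ← cfcₙ_add _ _ (b : A) (by fun_prop) (by simp [hu n]) (by fun_prop) (by simp [hu n]),
        star_cfcₙ_mul_self _ _ (by fun_prop) (by simp)]
      refine τ.mono (cfcₙ_nonneg fun x _ => add_nonneg (mul_self_nonneg _) (mul_self_nonneg _))
        (cfcₙ_mono (fun x _ => ?_) (by fun_prop) (by fun_prop)
          (by simp [hu n]) (by simp))
      have := hu n
      rcases le_total x 0 with h | h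
      · rw [min_eq_left h, min_eq_left (by linarith), max_eq_right (by linarith), max_eq_right h]; simp
      · rcases le_total x (u n) with h' | h'
        · rw [min_eq_right h, min_eq_left h', max_eq_right (by linarith), max_eq_left h]; simp
        · rw [min_eq_right h, min_eq_right h', max_eq_left (by linarith), max_eq_left h]
          nlinarith
    have h2 := ENNReal.toReal_mono hQs.ne h1
    have h3 := h1.trans_lt hQs
    rw [ENNReal.add_lt_top] at h3
    rw [ENNReal.toReal_add h3.1.ne h3.2.ne] at h2
    linarith
  have hle : ∀ n, (τ (star (P n) * P n)).toReal ≤ (τ (star Q * Q)).toReal := fun n => by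
    have := (sq_nonneg _).trans (bound n); linarith
  have hfin : ∀ n, τ (star (P n) * P n) < ∞ := fun n =>
    τ.cfcₙ_mem_sqIntegrable hb b.2 (fc _) (f0 n) fun x => abs_max_sub_le (hu n)
  have lim : Filter.Tendsto (fun n => (τ (star (P n) * P n)).toReal) Filter.atTop
      (nhds (τ (star Q * Q)).toReal) := by
    refine tendsto_order.2 ⟨fun y hy => ?_, fun y hy => .of_forall fun n => (hle n).trans_lt hy⟩
    -- `ENNReal.ofReal` collapses negative numbers to `0`, so they are treated apart.
    rcases lt_or_ge y 0 with y0 | y0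
    · exact .of_forall fun n => y0.trans_le ENNReal.toReal_nonneg
    have hy' : ENNReal.ofReal y < τ (star Q * Q) :=
      (ENNReal.ofReal_lt_iff_lt_toReal y0 hQs.ne).2 hy
    have h1 := τ.lowerSemicontinuous' (star Q * Q) (star_mul_self_nonneg Q) _ hy'
    have h2 : Filter.Tendsto (fun n => star (P n) * P n) Filter.atTop
        (nhdsWithin (star Q * Q) {a | 0 ≤ a}) :=
      tendsto_nhdsWithin_iff.2 ⟨hPQ.star.mul hPQ, .of_forall fun n => star_mul_self_nonneg _⟩
    filter_upwards [h2.eventually h1] with n hn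
    exact (ENNReal.ofReal_lt_iff_lt_toReal y0 (hfin n).ne).1 hn
  rw [tendsto_iff_norm_sub_tendsto_zero]
  have h0 : Filter.Tendsto (fun n => √((τ (star Q * Q)).toReal - (τ (star (P n) * P n)).toReal))
      Filter.atTop (nhds 0) := by
    have := (tendsto_const_nhds (x := (τ (star Q * Q)).toReal)).sub lim
    rw [sub_self] at this
    simpa using this.sqrt
  exact squeeze_zero (fun n => norm_nonneg _) (fun n => Real.le_sqrt_of_sq_le (bound n)) h0

/-- Test against `p = (-a - ε)₊`: pairing with `p` is nonnegative on the cone, yet `Re (p, a) ≤ -ε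
τ(p)`. Hence `τ(p) = 0`, so `p = 0` by faithfulness and the spectrum of `a` is bounded below by
`-ε`. The shift by `ε` makes `τ(p)` finite. -/
lemma nonneg_of_toL2_mem_posCone {a : τ.sqIntegrable} (ha : τ.toL2 a ∈ τ.posCone) :
    0 ≤ (a : A) := by
  have hsa : IsSelfAdjoint (a : A) := by
    have h : τ.toL2 a ∈ {ζ | τ.J ζ = ζ} := by
      refine closure_minimal ?_ (isClosed_eq τ.continuous_J continuous_id) ha
      rintro _ ⟨c, hc, rfl⟩
      change τ.J _ = _
      rw [J_toL2]
      congr 1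
      exact Subtype.ext (IsSelfAdjoint.of_nonneg hc).star_eq
    change τ.J _ = _ at h
    rw [J_toL2] at h
    exact congrArg Subtype.val (τ.toL2_injective h)
  have spec : ∀ ε > 0, ∀ x ∈ quasispectrum ℝ (a : A), -ε ≤ x := by
    intro ε hε
    have fc : Continuous fun x : ℝ => max (-x - ε) 0 := by fun_prop
    have f0 : max (-(0 : ℝ) - ε) 0 = 0 := max_eq_right (by linarith)
    have hf0 : ∀ x : ℝ, 0 ≤ max (-x - ε) 0 := fun x => le_max_right _ _
    have hf1 : ∀ x : ℝ, |max (-x - ε) 0| ≤ |x| := fun x =>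
      abs_neg x ▸ abs_max_sub_le (x := -x) hε.le
    have hf2 : ∀ x : ℝ, max (-x - ε) 0 ≤ ε⁻¹ * (x * x) := fun x =>
      neg_mul_neg x x ▸ max_sub_le_mul (x := -x) hε
    have hr := (inv_pos.2 hε).le
    set s := cfcₙ (fun x : ℝ => √(max (-x - ε) 0)) (a : A) with hs
    set p := cfcₙ (fun x : ℝ => max (-x - ε) 0) (a : A) with hpdef
    have hp0 : 0 ≤ p := cfcₙ_nonneg fun x _ => hf0 x
    have hssa : IsSelfAdjoint s := cfcₙ_predicate _ _
    have hp : p = s * s := cfcₙ_sqrt_mul_self (a : A) fc f0 hf0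
    have hpf : τ p < ∞ := τ.trace_cfcₙ_lt_top hsa a.2 fc f0 hf0 hr hf2
    have key : ∀ c : τ.sqIntegrable, IsSelfAdjoint (c : A) → s * c * s ≤ p →
        (inner ℂ (τ.toL2 ⟨p, τ.cfcₙ_mem_sqIntegrable hsa a.2 fc f0 hf1⟩) (τ.toL2 c)).re =
          (τ p).toReal - (τ (p - s * c * s)).toReal :=
      fun c hc h => τ.re_inner_cfcₙ hsa a.2 fc f0 hf0 hf1 hr hf2 hc h
    have pos : ∀ ζ ∈ τ.posCone,
        0 ≤ (inner ℂ (τ.toL2 ⟨p, τ.cfcₙ_mem_sqIntegrable hsa a.2 fc f0 hf1⟩) ζ).re := by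
      refine fun ζ hζ => closure_minimal (t := {ζ | 0 ≤ (inner ℂ _ ζ).re}) ?_
        (isClosed_le (by fun_prop) (by fun_prop)) hζ
      rintro _ ⟨c, hc : 0 ≤ (c : A), rfl⟩
      have hscs : 0 ≤ s * c * s := hssa.conjugate_nonneg hc
      have e : s * ((-c : τ.sqIntegrable) : A) * s = -(s * c * s) := by
        rw [Submodule.coe_neg]; noncomm_ring
      have hcsa : IsSelfAdjoint ((-c : τ.sqIntegrable) : A) := by
        rw [Submodule.coe_neg]; exact (IsSelfAdjoint.of_nonneg hc).neg
      -- The formula needs an upper bound on the conjugated element. For `-c` it is automatic, since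
      -- `-scs ≤ 0 ≤ p`, while `scs ≤ p` may fail.
      have h1 := key (-c) hcsa (by rw [e]; exact (neg_nonpos.2 hscs).trans hp0)
      have h2 := τ.toReal_sub_conjugate_mono hssa hcsa (hp ▸ hpf) hp0
        (by rw [e, ← hp, sub_neg_eq_add]; exact le_add_of_nonneg_right hscs)
      rw [_root_.map_neg, inner_neg_right, Complex.neg_re] at h1
      rw [← hp] at h2
      change 0 ≤ (inner ℂ _ (τ.toL2 c)).re
      linarith
    have hsas : s * a * s ≤ -(ε • p) := by
      rw [hpdef, ← cfcₙ_const_mul ε (fun x : ℝ => max (-x - ε) 0) (a : A) (by fun_prop) f0, ← cfcₙ_neg]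
      conv_lhs => rw [← cfcₙ_id' ℝ (a : A)]
      rw [hs, ← cfcₙ_mul _ _ (a : A) (by fun_prop) (by simp [hε.le]) (by fun_prop) (by norm_num),
        ← cfcₙ_mul _ _ (a : A) (by fun_prop) (by simp) (by fun_prop) (by simp [hε.le])]
      refine cfcₙ_mono (fun x _ => ?_) (by fun_prop) (by fun_prop) (by simp) (by simp [hε.le])
      rw [mul_right_comm, Real.mul_self_sqrt (hf0 x)]
      rcases le_total (-x - ε) 0 with h | h
      · rw [max_eq_right h]; simp
      · rw [max_eq_left h]; nlinarith
    have hεp : 0 ≤ ε • p := smul_nonneg hε.le hp0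
    have h1 := key a hsa (hsas.trans ((neg_nonpos.2 hεp).trans hp0))
    have h2 := pos _ ha
    have h3 := τ.toReal_sub_conjugate_mono (c := p + ε • p) hssa hsa (hp ▸ hpf)
      (add_nonneg hp0 hεp) (by rw [← hp]; have := sub_le_sub_left hsas p; rwa [sub_neg_eq_add] at this)
    rw [τ.map_add' _ _ hp0 hεp, τ.map_real_smul hε.le hp0, ENNReal.toReal_add hpf.ne
      (ENNReal.mul_ne_top ENNReal.ofReal_ne_top hpf.ne), ENNReal.toReal_mul,
      ENNReal.toReal_ofReal hε.le, ← hp] at h3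
    have h4 : (τ p).toReal = 0 := by
      have := ENNReal.toReal_nonneg (a := τ p)
      nlinarith
    have h5 : p = 0 := τ.faithful' p hp0 ((ENNReal.toReal_eq_zero_iff _).1 h4 |>.resolve_right hpf.ne)
    intro x hx
    have h6 := (norm_cfcₙ_le_iff (fun x : ℝ => max (-x - ε) 0) (a : A) 0 (by fun_prop) f0 hsa).1
      (by rw [← hpdef, h5, norm_zero]) x hx
    rw [Real.norm_of_nonneg (hf0 x)] at h6
    have := (le_max_left _ _).trans h6
    linarith
  rw [← cfcₙ_id' ℝ (a : A)]
  exact cfcₙ_nonneg fun x hx => le_of_forall_pos_le_add fun ε hε => by linarith [spec ε hε x hx]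

end CStarTrace

/-! ### The graph space as a Hilbert space, and lower semicontinuity of its norm -/

/-- The limit of a sequence bounded in `V` and convergent in `H` lies in `V`, with the same bound. -/
lemma ContinuousLinearMap.exists_norm_le_of_tendsto {V H : Type*} [NormedAddCommGroup V]
    [InnerProductSpace ℂ V] [CompleteSpace V] [NormedAddCommGroup H] [InnerProductSpace ℂ H]
    [CompleteSpace H] (ι : V →L[ℂ] H) (hι : Function.Injective ι) {v : ℕ → V} {M : ℝ} (hM : 0 ≤ M)
    (hv : ∀ n, ‖v n‖ ≤ M) {u : H} (hu : Filter.Tendsto (fun n => ι (v n)) Filter.atTop (nhds u)) :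
    ∃ x, ι x = u ∧ ‖x‖ ≤ M := by
  -- By this bound `⟨u, ·⟩` factors through `ι⋆` as a functional of norm at most `M`. The range of
  -- `ι⋆` is dense because `ι` is injective, so the functional extends and its Riesz vector is the
  -- preimage of `u`.
  have bound : ∀ y : H, ‖innerSL ℂ u y‖ ≤ M * ‖adjoint ι y‖ := by
    intro y
    have h1 : Filter.Tendsto (fun n => ‖inner ℂ (ι (v n)) y‖) Filter.atTop
        (nhds ‖inner ℂ u y‖) := (hu.inner tendsto_const_nhds).norm
    refine le_of_tendsto h1 (.of_forall fun n => ?_)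
    rw [← adjoint_inner_right]
    exact (norm_inner_le_norm _ _).trans (mul_le_mul_of_nonneg_right (hv n) (norm_nonneg _))
  have hdense : DenseRange (adjoint ι : H →ₗ[ℂ] V) := by
    have h : (LinearMap.range (adjoint ι : H →ₗ[ℂ] V))ᗮ = ⊥ := by
      have h2 := ContinuousLinearMap.orthogonal_range (adjoint ι)
      rw [adjoint_adjoint] at h2
      exact h2.trans (LinearMap.ker_eq_bot.2 hι)
    have h3 := Submodule.topologicalClosure_eq_top_iff.2 h
    intro x
    have : x ∈ (LinearMap.range (adjoint ι : H →ₗ[ℂ] V)).topologicalClosure := h3 ▸ Submodule.mem_top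
    exact this
  set f := (innerSL ℂ u : H →ₗ[ℂ] ℂ).extendOfNorm (adjoint ι : H →ₗ[ℂ] V) with hf
  have hfe : ∀ y, f (adjoint ι y) = inner ℂ u y := fun y =>
    LinearMap.extendOfNorm_eq hdense ⟨M, bound⟩ y
  refine ⟨(InnerProductSpace.toDual ℂ V).symm f, ?_, ?_⟩
  · refine ext_inner_right ℂ fun y => ?_
    rw [← adjoint_inner_right, InnerProductSpace.toDual_symm_apply, hfe]
  · rw [LinearIsometryEquiv.norm_map]
    exact LinearMap.opNorm_extendOfNorm_le hdense hM bound

namespace ClosedForm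

variable {H : Type*} [NormedAddCommGroup H] [InnerProductSpace ℂ H] (E : ClosedForm H)

/-- The domain of a closed form, with the graph norm. -/
def GraphSpace : Type _ := E.domain

noncomputable instance : AddCommGroup E.GraphSpace := inferInstanceAs (AddCommGroup E.domain)
noncomputable instance : Module ℂ E.GraphSpace := inferInstanceAs (Module ℂ E.domain)

/-- The identity map from the domain to the graph space. -/
noncomputable def toGraph : E.domain ≃ₗ[ℂ] E.GraphSpace := LinearEquiv.refl ℂ _

/-- The inner product `⟨·, ·⟩_𝓕`. -/
@[reducible] noncomputable def graphCore : InnerProductSpace.Core ℂ E.GraphSpace where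
  inner x y := E.innerF (E.toGraph.symm x) (E.toGraph.symm y)
  conj_inner_symm x y := by
    simp only [innerF, map_add, inner_conj_symm]
    rw [E.hermitian (E.toGraph.symm x)]
    rfl
  re_inner_nonneg x := by
    rw [innerF_self, RCLike.re_to_complex, Complex.ofReal_re]
    positivity
  add_left x y z := by
    simp only [innerF, map_add, LinearMap.add_apply, Submodule.coe_add, inner_add_left]
    ring
  smul_left x y r := by
    simp only [innerF, map_smul, LinearMap.map_smulₛₗ, LinearMap.smul_apply, Submodule.coe_smul,
      inner_smul_left, smul_eq_mul]
    ring
  definite x h := by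
    rw [innerF_self, Complex.ofReal_eq_zero, normF_sq] at h
    have h1 := E.energy_nonneg (E.toGraph.symm x)
    have h2 : ‖((E.toGraph.symm x : E.domain) : H)‖ = 0 := by
      nlinarith [norm_nonneg ((E.toGraph.symm x : E.domain) : H)]
    exact E.toGraph.symm.map_eq_zero_iff.1 (Subtype.ext (norm_eq_zero.1 h2))

noncomputable instance : NormedAddCommGroup E.GraphSpace := E.graphCore.toNormedAddCommGroup
noncomputable instance : InnerProductSpace ℂ E.GraphSpace := .ofCore E.graphCore.toCore

lemma inner_toGraph (x y : E.domain) : inner ℂ (E.toGraph x) (E.toGraph y) = E.innerF x y := rfl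

lemma norm_toGraph (x : E.domain) : ‖E.toGraph x‖ = E.normF x := by
  have h := norm_sq_eq_re_inner (𝕜 := ℂ) (E.toGraph x)
  rw [inner_toGraph, innerF_self, RCLike.re_to_complex, Complex.ofReal_re] at h
  exact (sq_eq_sq₀ (norm_nonneg _) (Real.sqrt_nonneg _)).1 h

lemma norm_le_normF (x : E.domain) : ‖(x : H)‖ ≤ E.normF x :=
  Real.le_sqrt_of_sq_le (le_add_of_nonneg_left (E.energy_nonneg x))

lemma energy_le_normF_sq (x : E.domain) : E.energy x ≤ E.normF x ^ 2 := by
  rw [normF_sq]; exact le_add_of_nonneg_right (sq_nonneg _)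

/-- The inclusion of the graph space. -/
noncomputable def inclusion : E.GraphSpace →L[ℂ] H :=
  (E.domain.subtype ∘ₗ E.toGraph.symm.toLinearMap).mkContinuous 1 fun x => by
    rw [one_mul, ← E.toGraph.apply_symm_apply x, norm_toGraph]
    exact E.norm_le_normF _

lemma inclusion_injective : Function.Injective E.inclusion := fun _ _ h =>
  E.toGraph.symm.injective (Subtype.ext h)

instance [CompleteSpace H] : CompleteSpace E.GraphSpace := by
  refine Metric.complete_of_cauchySeq_tendsto fun u hu => ?_
  obtain ⟨ξ, hξ⟩ := cauchySeq_tendsto_of_complete (E.inclusion.uniformContinuous.comp_cauchySeq hu)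
  obtain ⟨η, hη, hlim⟩ := E.closed (fun n => E.toGraph.symm (u n)) ξ hξ fun ε hε => by
    obtain ⟨N, hN⟩ := Metric.cauchySeq_iff.1 hu (√ε) (Real.sqrt_pos.2 hε)
    refine ⟨N, fun k hk l hl => (E.energy_le_normF_sq _).trans_lt ?_⟩
    have := hN k hk l hl
    rw [dist_eq_norm] at this
    rw [← map_sub, ← norm_toGraph, LinearEquiv.apply_symm_apply]
    exact (Real.lt_sqrt (norm_nonneg _)).1 this
  refine ⟨E.toGraph η, ?_⟩
  rw [tendsto_iff_norm_sub_tendsto_zero]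
  have e : ∀ n, ‖u n - E.toGraph η‖ = √((E.form (E.toGraph.symm (u n) - η)
      (E.toGraph.symm (u n) - η)).re + ‖E.inclusion (u n) - η‖ ^ 2) := by
    intro n
    have h : u n - E.toGraph η = E.toGraph (E.toGraph.symm (u n) - η) := by
      rw [map_sub, LinearEquiv.apply_symm_apply]
    rw [h, norm_toGraph]
    rfl
  simp only [e]
  have h2 := tendsto_iff_norm_sub_tendsto_zero.1 hξ
  rw [← hη] at h2
  have := (hlim.add (h2.pow 2)).sqrt
  simpa using this

lemma exists_normF_le_of_tendsto [CompleteSpace H] {v : ℕ → E.domain} {M : ℝ} (hM : 0 ≤ M)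
    (hv : ∀ n, E.normF (v n) ≤ M) {u : H}
    (hu : Filter.Tendsto (fun n => (v n : H)) Filter.atTop (nhds u)) :
    ∃ h : u ∈ E.domain, E.normF ⟨u, h⟩ ≤ M := by
  obtain ⟨x, hx, hxM⟩ := E.inclusion.exists_norm_le_of_tendsto E.inclusion_injective hM
    (v := fun n => E.toGraph (v n)) (fun n => (E.norm_toGraph _).trans_le (hv n)) hu
  have h : u ∈ E.domain := hx ▸ (E.toGraph.symm x).2
  refine ⟨h, ?_⟩
  have : x = E.toGraph ⟨u, h⟩ := E.inclusion_injective hx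
  rwa [this, norm_toGraph] at hxM

end ClosedForm

namespace ClosedForm

variable {H : Type*} [NormedAddCommGroup H] [InnerProductSpace ℂ H] (E : ClosedForm H)

lemma normF_smul (c : ℂ) (x : E.domain) : E.normF (c • x) = ‖c‖ * E.normF x := by
  rw [← norm_toGraph, map_smul, norm_smul, norm_toGraph]

lemma normF_nonneg (x : E.domain) : 0 ≤ E.normF x := Real.sqrt_nonneg _

lemma normF_le_normF {x y : E.domain} (h : E.energy x ≤ E.energy y) (h' : ‖(x : H)‖ ≤ ‖(y : H)‖) :
    E.normF x ≤ E.normF y :=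
  Real.sqrt_le_sqrt (add_le_add h (pow_le_pow_left₀ (norm_nonneg _) h' 2))

end ClosedForm

/-! ### Scaling of truncations -/

namespace CStarTrace

variable {A : Type*} [NonUnitalCStarAlgebra A] [PartialOrder A] [StarOrderedRing A]
  (τ : CStarTrace A)

lemma norm_toL2_trunc_le (b : τ.sqIntegrable) (hb : IsSelfAdjoint (b : A)) {ε : ℝ} (hε : 0 ≤ ε) :
    ‖τ.toL2 (τ.trunc b hb ε hε)‖ ≤ ‖τ.toL2 b‖ := by
  rw [← sq_le_sq₀ (norm_nonneg _) (norm_nonneg _), norm_toL2_sq, norm_toL2_sq]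
  exact ENNReal.toReal_mono (ne_of_lt b.2) (τ.trace_cfcₙ_sq_le hb (by fun_prop) (min_eq_left hε)
    fun _ => abs_min_le hε)

lemma isSelfAdjoint_coe_smul {b : τ.sqIntegrable} (hb : IsSelfAdjoint (b : A)) (r : ℝ) :
    IsSelfAdjoint (((r : ℂ) • b : τ.sqIntegrable) : A) := by
  rw [Submodule.coe_smul]
  exact IsSelfAdjoint.smul (Complex.conj_ofReal r) hb

/-- Markovianity speaks only of the threshold `1`; this transfers it to every `ε > 0`. -/
lemma smul_trunc_one (b : τ.sqIntegrable) (hb : IsSelfAdjoint (b : A)) {ε : ℝ} (hε : 0 < ε) :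
    (ε : ℂ) • τ.trunc (((ε⁻¹ : ℝ) : ℂ) • b) (τ.isSelfAdjoint_coe_smul hb _) 1 zero_le_one =
      τ.trunc b hb ε hε.le := by
  refine Subtype.ext ?_
  change (ε : ℂ) • cfcₙ (fun x : ℝ => min x 1) (((ε⁻¹ : ℝ) : ℂ) • (b : A)) = cfcₙ _ (b : A)
  rw [Complex.coe_smul, Complex.coe_smul,
    ← cfcₙ_comp_smul ε⁻¹ (fun x : ℝ => min x 1) (b : A) (by fun_prop) (by simp) hb,
    ← cfcₙ_const_mul ε _ (b : A) (by fun_prop) (by simp)]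
  congr 1; ext x
  rw [mul_min_of_nonneg _ _ hε.le, smul_eq_mul, mul_inv_cancel_left₀ hε.ne', mul_one]

end CStarTrace

/-! ### Decompositions inside the Dirichlet algebra -/

namespace CStarDirichletForm

variable {A : Type*} [NonUnitalCStarAlgebra A] [PartialOrder A] [StarOrderedRing A]
  {τ : CStarTrace A} (D : CStarDirichletForm τ)

/-- The inclusion of `𝓑` into `𝓕` as a linear map. -/
noncomputable def toFₗ : D.algebraB →ₗ[ℂ] D.domain :=
  LinearMap.codRestrict D.domain (τ.toL2 ∘ₗ D.algebraB.subtype) fun b => b.2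

/-- The inclusion of `𝓑` into `A` as a linear map. -/
noncomputable def toAₗ : D.algebraB →ₗ[ℂ] A := τ.sqIntegrable.subtype ∘ₗ D.algebraB.subtype

/-- The inclusion of `𝓑` into the Hilbert space `𝓕`. -/
noncomputable def toGraphₗ : D.algebraB →ₗ[ℂ] D.GraphSpace := D.toGraph.toLinearMap ∘ₗ D.toFₗ

lemma norm_toGraphₗ (b : D.algebraB) : ‖D.toGraphₗ b‖ = D.normF (D.toF b) := D.norm_toGraph _

lemma inner_toGraphₗ (ξ : D.domain) (b : D.algebraB) :
    inner ℂ (D.toGraph ξ) (D.toGraphₗ b) = D.innerF ξ (D.toF b) := rfl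

lemma denseRange_toGraphₗ : DenseRange D.toGraphₗ := by
  refine Metric.denseRange_iff.2 fun x ε hε => ?_
  obtain ⟨b, h, hb⟩ := D.core (D.toGraph.symm x) ε hε
  refine ⟨⟨b, h⟩, ?_⟩
  rw [dist_eq_norm]
  rw [← ClosedForm.norm_toGraph, map_sub, LinearEquiv.apply_symm_apply] at hb
  exact hb

/-- Markovianity and scaling bound the graph norm of `b ∧ ε` by that of `b`, uniformly in `ε`; the
`L²`-limit as `ε → 0` inherits the bound. -/
lemma truncZero_mem (b : D.algebraB) (hb : IsSelfAdjoint (D.toA b)) :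
    ∃ h : τ.toL2 (τ.trunc b hb 0 le_rfl) ∈ D.domain, D.normF ⟨_, h⟩ ≤ D.normF (D.toF b) := by
  have step : ∀ n : ℕ, ∃ h : τ.toL2 (τ.trunc b hb (1 / ((n : ℝ) + 1)) (by positivity)) ∈ D.domain,
      D.normF ⟨_, h⟩ ≤ D.normF (D.toF b) := by
    intro n
    have hε : 0 < 1 / ((n : ℝ) + 1) := by positivity
    set ε := 1 / ((n : ℝ) + 1)
    have hreal : τ.J (((((ε⁻¹ : ℝ) : ℂ) • D.toF b : D.domain)) : τ.L2) =
        ((((ε⁻¹ : ℝ) : ℂ) • D.toF b : D.domain) : τ.L2) := by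
      change τ.J (((ε⁻¹ : ℝ) : ℂ) • τ.toL2 b) = ((ε⁻¹ : ℝ) : ℂ) • τ.toL2 b
      rw [← map_smul, CStarTrace.J_toL2]
      congr 1
      exact Subtype.ext (τ.isSelfAdjoint_coe_smul hb _).star_eq
    have hmeet := τ.isMeetOne_trunc (((ε⁻¹ : ℝ) : ℂ) • (b : τ.sqIntegrable))
      (τ.isSelfAdjoint_coe_smul hb _)
    have ec : ((((ε⁻¹ : ℝ) : ℂ) • D.toF b : D.domain) : τ.L2) =
        τ.toL2 (((ε⁻¹ : ℝ) : ℂ) • (b : τ.sqIntegrable)) := (map_smul _ _ _).symm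
    rw [← ec] at hmeet
    obtain ⟨h, hE⟩ := D.markovian (((ε⁻¹ : ℝ) : ℂ) • D.toF b) hreal _ hmeet
    have hle := D.normF_le_normF (x := ⟨_, h⟩) hE
      ((τ.norm_toL2_trunc_le _ _ zero_le_one).trans_eq (congrArg _ ec.symm))
    have e := congrArg τ.toL2 (τ.smul_trunc_one b hb hε)
    rw [map_smul] at e
    have hd := D.domain.smul_mem (ε : ℂ) h
    rw [e] at hd
    refine ⟨hd, ?_⟩
    have e' : (⟨_, hd⟩ : D.domain) = (ε : ℂ) • (⟨_, h⟩ : D.domain) := Subtype.ext e.symm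
    rw [e', D.normF_smul]
    calc _ ≤ ‖(ε : ℂ)‖ * D.normF (((ε⁻¹ : ℝ) : ℂ) • D.toF b) := by gcongr
      _ = D.normF (D.toF b) := by
        rw [D.normF_smul, ← mul_assoc, ← norm_mul, ← Complex.ofReal_mul,
          mul_inv_cancel₀ hε.ne']
        simp
  exact D.exists_normF_le_of_tendsto (D.normF_nonneg _)
    (v := fun n => ⟨_, (step n).choose⟩) (fun n => (step n).choose_spec)
    (τ.tendsto_toL2_trunc b hb (fun n => by positivity) tendsto_one_div_add_atTop_nhds_zero_nat)

/-- A self-adjoint element of `𝓑` is a difference of positive ones of no larger graph norm. -/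
lemma exists_pos_sub_pos (b : D.algebraB) (hb : IsSelfAdjoint (D.toA b)) :
    ∃ p q : D.algebraB, b = p - q ∧ 0 ≤ D.toA p ∧ 0 ≤ D.toA q ∧
      D.normF (D.toF p) ≤ D.normF (D.toF b) ∧ D.normF (D.toF q) ≤ D.normF (D.toF b) := by
  have hnb : IsSelfAdjoint (D.toA (-b)) := hb.neg
  obtain ⟨h1, e1⟩ := D.truncZero_mem b hb
  obtain ⟨h2, e2⟩ := D.truncZero_mem (-b) hnb
  -- `b ∧ 0 = -b₋` and `(-b) ∧ 0 = -b₊`, so negation gives both parts.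
  set q : D.algebraB := -⟨_, h1⟩ with hq
  set p : D.algebraB := -⟨_, h2⟩ with hp
  have hqA : D.toA q = cfcₙ (fun x : ℝ => -min x 0) (D.toA b) := by
    rw [cfcₙ_neg]; rfl
  have hpA : D.toA p = cfcₙ (fun x : ℝ => -min (-x) 0) (D.toA b) := by
    rw [cfcₙ_neg, cfcₙ_comp_neg (fun x : ℝ => min x 0) (D.toA b) (by fun_prop) (by simp) hb]
    rfl
  refine ⟨p, q, ?_, ?_, ?_, ?_, ?_⟩
  · refine Subtype.ext (Subtype.ext ?_)
    change D.toA b = D.toA p - D.toA q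
    rw [hpA, hqA, ← cfcₙ_sub (fun x : ℝ => -min (-x) 0) (fun x : ℝ => -min x 0) (D.toA b)
      (by fun_prop) (by simp) (by fun_prop) (by simp)]
    conv_lhs => rw [← cfcₙ_id' ℝ (D.toA b)]
    congr 1; ext x
    rcases le_total x 0 with h | h
    · rw [min_eq_left h, min_eq_right (by linarith)]; ring
    · rw [min_eq_right h, min_eq_left (by linarith)]; ring
  · rw [hpA]; exact cfcₙ_nonneg fun x _ => neg_nonneg.2 (min_le_right _ _)
  · rw [hqA]; exact cfcₙ_nonneg fun x _ => neg_nonneg.2 (min_le_right _ _)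
  · rw [← norm_toGraphₗ, ← norm_toGraphₗ, hp, map_neg, norm_neg, ← norm_neg (D.toGraphₗ b),
      ← map_neg, norm_toGraphₗ, norm_toGraphₗ]
    exact e2
  · rw [← norm_toGraphₗ, hq, map_neg, norm_neg, norm_toGraphₗ]
    exact e1

/-- Real and imaginary parts of an element of `𝓑` lie in `𝓑` and have no larger graph norm. -/
lemma exists_re_im (b : D.algebraB) :
    ∃ h k : D.algebraB, b = h + Complex.I • k ∧ IsSelfAdjoint (D.toA h) ∧ IsSelfAdjoint (D.toA k) ∧
      D.normF (D.toF h) ≤ D.normF (D.toF b) ∧ D.normF (D.toF k) ≤ D.normF (D.toF b) := by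
  obtain ⟨hJ, hE⟩ := D.real (D.toF b)
  have eJ : τ.J (D.toF b) = τ.toL2 ⟨star (D.toA b), τ.star_mem (b : τ.sqIntegrable).2⟩ :=
    τ.J_toL2 _
  have hmem : τ.toL2 ⟨star (D.toA b), τ.star_mem (b : τ.sqIntegrable).2⟩ ∈ D.domain := eJ ▸ hJ
  set c : D.algebraB := ⟨_, hmem⟩ with hc
  have hcA : D.toA c = star (D.toA b) := rfl
  have hcF : D.normF (D.toF c) = D.normF (D.toF b) := by
    have e : D.toF c = ⟨τ.J (D.toF b), hJ⟩ := Subtype.ext eJ.symm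
    have hn : ‖τ.toL2 ⟨star (D.toA b), τ.star_mem (b : τ.sqIntegrable).2⟩‖ = ‖τ.toL2 b‖ := by
      rw [← sq_eq_sq₀ (norm_nonneg _) (norm_nonneg _), CStarTrace.norm_toL2_sq,
        CStarTrace.norm_toL2_sq, τ.tracial' ((b : τ.sqIntegrable) : A)]
      change (τ (star (star (D.toA b)) * _)).toReal = _
      rw [star_star]; rfl
    refine le_antisymm (D.normF_le_normF ?_ hn.le) (D.normF_le_normF ?_ hn.ge)
    · rw [e]; exact hE.le
    · rw [e]; exact hE.ge
  -- Both parts of `b` combine `b` and `b⋆`, of equal graph norm, with coefficients of modulus `1 /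
  -- 2`.
  have bound : ∀ z w : ℂ, ‖z‖ = 1 / 2 → ‖w‖ = 1 / 2 →
      D.normF (D.toF (z • b + w • c)) ≤ D.normF (D.toF b) := by
    intro z w hz hw
    rw [← norm_toGraphₗ, map_add, map_smul, map_smul]
    refine (norm_add_le _ _).trans ?_
    rw [norm_smul, norm_smul, norm_toGraphₗ, norm_toGraphₗ, hcF, hz, hw]
    linarith
  refine ⟨(1 / 2 : ℂ) • b + (1 / 2 : ℂ) • c, (-(Complex.I / 2)) • b + (Complex.I / 2) • c,
    ?_, ?_, ?_, bound _ _ (by simp) (by simp), bound _ _ (by simp) (by simp)⟩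
  · have h1 : Complex.I * -(Complex.I / 2) = 1 / 2 := by
      linear_combination (-1 / 2 : ℂ) * Complex.I_mul_I
    have h2 : Complex.I * (Complex.I / 2) = -(1 / 2) := by
      linear_combination (1 / 2 : ℂ) * Complex.I_mul_I
    rw [smul_add, smul_smul, smul_smul, h1, h2]
    module
  · change star ((1 / 2 : ℂ) • D.toA b + (1 / 2 : ℂ) • star (D.toA b)) =
      (1 / 2 : ℂ) • D.toA b + (1 / 2 : ℂ) • star (D.toA b)
    simp [star_add, star_smul, add_comm]
  · change star ((-(Complex.I / 2)) • D.toA b + (Complex.I / 2) • star (D.toA b)) =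
      (-(Complex.I / 2)) • D.toA b + (Complex.I / 2) • star (D.toA b)
    simp [star_add, star_smul, add_comm, neg_div]

/-! ### Finite energy, potentials and their positivity -/

variable {D} {ω ω' : StrongDual ℂ A}

lemma toF_mem_posF {b : D.algebraB} (hb : 0 ≤ D.toA b) : D.toF b ∈ D.posF :=
  subset_closure ⟨b, hb, rfl⟩

lemma nonneg_of_toF_mem_posF {b : D.algebraB} (hb : D.toF b ∈ D.posF) : 0 ≤ D.toA b :=
  τ.nonneg_of_toL2_mem_posCone hb

lemma HasFiniteEnergy.of_le (hle : FunctionalLE ω' ω) (h : D.HasFiniteEnergy ω) :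
    D.HasFiniteEnergy ω' := by
  obtain ⟨c, hc, H⟩ := h
  exact ⟨c, hc, fun b hb => (Complex.le_def.1 (hle _ (nonneg_of_toF_mem_posF hb))).1.trans (H b hb)⟩

/-- The one-sided bound on `𝓑₊` spreads to `𝓑`: one factor `2` for positive and negative parts,
another for real and imaginary parts. -/
lemma HasFiniteEnergy.exists_norm_le (hω : IsPositiveFunctional ω) (h : D.HasFiniteEnergy ω) :
    ∃ C : ℝ, ∀ b : D.algebraB, ‖ω (D.toA b)‖ ≤ C * D.normF (D.toF b) := by
  obtain ⟨c, hc, H⟩ := h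
  have hpos : ∀ p : D.algebraB, 0 ≤ D.toA p → ‖ω (D.toA p)‖ ≤ c * D.normF (D.toF p) := by
    intro p hp
    have h0 := hω _ hp
    rw [← Complex.re_eq_norm.2 h0]
    exact H p (toF_mem_posF hp)
  have hsa : ∀ b : D.algebraB, IsSelfAdjoint (D.toA b) →
      ‖ω (D.toA b)‖ ≤ 2 * c * D.normF (D.toF b) := by
    intro b hb
    obtain ⟨p, q, rfl, hp, hq, hpn, hqn⟩ := D.exists_pos_sub_pos b hb
    change ‖ω (D.toA p - D.toA q)‖ ≤ _
    rw [map_sub]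
    refine (norm_sub_le _ _).trans ?_
    have h1 := (hpos p hp).trans (mul_le_mul_of_nonneg_left hpn hc)
    have h2 := (hpos q hq).trans (mul_le_mul_of_nonneg_left hqn hc)
    linarith
  refine ⟨4 * c, fun b => ?_⟩
  obtain ⟨h, k, rfl, hh, hk, hhn, hkn⟩ := D.exists_re_im b
  change ‖ω (D.toA h + Complex.I • D.toA k)‖ ≤ _
  rw [map_add, map_smul]
  refine (norm_add_le _ _).trans ?_
  rw [norm_smul, Complex.norm_I, one_mul]
  have h1 := (hsa h hh).trans (mul_le_mul_of_nonneg_left hhn (by positivity))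
  have h2 := (hsa k hk).trans (mul_le_mul_of_nonneg_left hkn (by positivity))
  linarith

lemma IsPotentialOf.unique {ξ η : D.domain} (hξ : D.IsPotentialOf ω ξ)
    (hη : D.IsPotentialOf ω η) : ξ = η := by
  refine D.toGraph.injective (ext_inner_right ℂ fun v => ?_)
  refine congrFun (D.denseRange_toGraphₗ.equalizer 
    (g := fun v => inner ℂ (D.toGraph ξ) v) (h := fun v => inner ℂ (D.toGraph η) v)
    (by fun_prop) (by fun_prop) ?_) v
  ext b
  exact (hξ b).symm.trans (hη b)

lemma HasFiniteEnergy.exists_potential (hω : IsPositiveFunctional ω) (h : D.HasFiniteEnergy ω) :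
    ∃ ξ, D.IsPotentialOf ω ξ := by
  obtain ⟨C, hC⟩ := h.exists_norm_le hω
  set f := (ω.toLinearMap ∘ₗ D.toAₗ).extendOfNorm D.toGraphₗ with hf
  refine ⟨D.toGraph.symm ((InnerProductSpace.toDual ℂ D.GraphSpace).symm f), fun b => ?_⟩
  rw [← inner_toGraphₗ, LinearEquiv.apply_symm_apply, InnerProductSpace.toDual_symm_apply, hf,
    LinearMap.extendOfNorm_eq D.denseRange_toGraphₗ
      ⟨C, fun b => (hC b).trans_eq (by rw [norm_toGraphₗ])⟩]
  rfl

lemma HasFiniteEnergy.isPotentialOf_potential (hω : IsPositiveFunctional ω)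
    (h : D.HasFiniteEnergy ω) : D.IsPotentialOf ω (D.potential ω) := by
  have := h.exists_potential hω
  rw [potential, dif_pos this]
  exact this.choose_spec

/-- The potential of a positive functional is a limit in `𝓕` of positive elements of `𝓑`. -/
lemma IsPotentialOf.exists_pos_norm_sub_lt (hω : IsPositiveFunctional ω) {ξ : D.domain}
    (hξ : D.IsPotentialOf ω ξ) {ε : ℝ} (hε : 0 < ε) :
    ∃ p : D.algebraB, 0 ≤ D.toA p ∧ ‖D.toGraph ξ - D.toGraphₗ p‖ < ε := by
  obtain ⟨b, hb⟩ := Metric.denseRange_iff.1 D.denseRange_toGraphₗ (D.toGraph ξ) ε hε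
  obtain ⟨h, k, hbk, hh, hk, hhn, -⟩ := D.exists_re_im b
  obtain ⟨p, q, hpq, hp, hq, hpn, -⟩ := D.exists_pos_sub_pos h hh
  obtain ⟨p', q', hpq', hp', hq', -⟩ := D.exists_pos_sub_pos k hk
  refine ⟨p, hp, lt_of_le_of_lt ?_ hb⟩
  rw [dist_eq_norm, ← sq_le_sq₀ (norm_nonneg _) (norm_nonneg _), norm_sub_sq (𝕜 := ℂ),
    norm_sub_sq (𝕜 := ℂ), inner_toGraphₗ, inner_toGraphₗ, ← hξ p, ← hξ b, norm_toGraphₗ,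
    norm_toGraphₗ]
  have e : D.toA b = D.toA p - D.toA q + Complex.I • (D.toA p' - D.toA q') := by
    rw [hbk, hpq, hpq']; rfl
  have him := fun a ha => (Complex.nonneg_iff.1 (hω a ha)).2
  -- `ω` is real on the imaginary part of `b`, which therefore drops out; discarding the negative
  -- part `q` can only increase the value.
  have hre : (ω (D.toA b)).re ≤ (ω (D.toA p)).re := by
    rw [e, map_add, map_smul, map_sub, map_sub]
    have := (Complex.nonneg_iff.1 (hω _ hq)).1
    simp only [Complex.add_re, Complex.sub_re, smul_eq_mul, Complex.mul_re, Complex.I_re,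
      Complex.I_im, Complex.sub_im, ← him _ hp', ← him _ hq']
    linarith
  have hn := pow_le_pow_left₀ (D.normF_nonneg _) (hpn.trans hhn) 2
  simp only [RCLike.re_to_complex]
  linarith

lemma IsPotentialOf.mem_posF (hω : IsPositiveFunctional ω) {ξ : D.domain}
    (hξ : D.IsPotentialOf ω ξ) : ξ ∈ D.posF := by
  change (ξ : τ.L2) ∈ closure _
  rw [Metric.mem_closure_iff]
  intro ε hε
  obtain ⟨p, hp, h⟩ := hξ.exists_pos_norm_sub_lt hω hε
  refine ⟨_, ⟨p, hp, rfl⟩, lt_of_le_of_lt ?_ h⟩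
  rw [dist_eq_norm]
  exact (D.norm_le_normF (ξ - D.toF p)).trans_eq (D.norm_toGraph _).symm

/-- On positive `p` in `𝓑` the pairing is `ω(p) ≥ 0`. Such `p` approximate `η` in the graph norm;
approximation in `L²` alone would not control the energy part of the pairing. -/
lemma IsPotentialOf.re_innerF_nonneg (hω : IsPositiveFunctional ω)
    (hω' : IsPositiveFunctional ω') {ξ η : D.domain} (hξ : D.IsPotentialOf ω ξ)
    (hη : D.IsPotentialOf ω' η) : 0 ≤ (D.innerF ξ η).re := by
  have hcl : IsClosed {v : D.GraphSpace | 0 ≤ (inner ℂ (D.toGraph ξ) v).re} :=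
    isClosed_le continuous_const (Complex.continuous_re.comp (continuous_const.inner continuous_id))
  refine closure_minimal (s := D.toGraphₗ '' {p | 0 ≤ D.toA p}) ?_ hcl
    (Metric.mem_closure_iff.2 fun ε hε => ?_ : D.toGraph η ∈ _)
  · rintro _ ⟨p, hp, rfl⟩
    change 0 ≤ (inner ℂ _ _).re
    rw [inner_toGraphₗ, ← hξ p]
    exact (Complex.nonneg_iff.1 (hω _ hp)).1
  · obtain ⟨p, hp, h⟩ := hη.exists_pos_norm_sub_lt hω' hε
    exact ⟨_, ⟨p, hp, rfl⟩, by rwa [dist_eq_norm]⟩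

lemma IsPotentialOf.sub {ξ η : D.domain} (hξ : D.IsPotentialOf ω ξ)
    (hη : D.IsPotentialOf ω' η) : D.IsPotentialOf (ω - ω') (ξ - η) := by
  intro b
  rw [← inner_toGraphₗ, map_sub, inner_sub_left, inner_toGraphₗ, inner_toGraphₗ, ← hξ b, ← hη b]
  rfl

end CStarDirichletForm

theorem proposition3p11 {A : Type*} [NonUnitalCStarAlgebra A] [PartialOrder A] [StarOrderedRing A]
    [TopologicalSpace.SeparableSpace A] (τ : CStarTrace A) (D : CStarDirichletForm τ)
    (ω ω' : StrongDual ℂ A) (hω : IsPositiveFunctional ω) (hω' : IsPositiveFunctional ω')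
    (hle : FunctionalLE ω' ω) (hfin : D.HasFiniteEnergy ω) :
    D.HasFiniteEnergy ω' ∧
      (∃! ξ, D.IsPotentialOf ω ξ) ∧ (∃! ξ, D.IsPotentialOf ω' ξ) ∧
      D.IsPotentialOf ω (D.potential ω) ∧ D.IsPotentialOf ω' (D.potential ω') ∧
      D.potential ω - D.potential ω' ∈ D.posF ∧
      D.energyContent ω' ≤ D.energyContent ω := by
  have hfin' := hfin.of_le hle
  have hG := hfin.isPotentialOf_potential hω
  have hG' := hfin'.isPotentialOf_potential hω'
  have hν : IsPositiveFunctional (ω - ω') := fun a ha => sub_nonneg.2 (hle a ha)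
  have hsub := hG.sub hG'
  refine ⟨hfin', ⟨_, hG, fun _ h => h.unique hG⟩, ⟨_, hG', fun _ h => h.unique hG'⟩, hG, hG',
    hsub.mem_posF hν, ?_⟩
  -- This is the cross term in the expansion of `‖G(ω') + (G(ω) - G(ω'))‖²`.
  have h1 := hG'.re_innerF_nonneg hω' hν hsub
  have h2 := norm_add_sq (𝕜 := ℂ) (D.toGraph (D.potential ω'))
    (D.toGraph (D.potential ω - D.potential ω'))
  rw [← map_add, add_sub_cancel, ClosedForm.inner_toGraph, RCLike.re_to_complex,
    ClosedForm.norm_toGraph, ClosedForm.norm_toGraph] at h2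
  unfold CStarDirichletForm.energyContent
  rw [ClosedForm.innerF_self, ClosedForm.innerF_self, Complex.ofReal_re, Complex.ofReal_re]
  nlinarith [sq_nonneg ‖D.toGraph (D.potential ω - D.potential ω')‖]
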